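/- All graphs are finite and simple. For a graph $G$, let $\omega(G)$ denote its number of components; a set $S\subseteq V(G)$ is a vertex cut of $G$ if $G-S$ is disconnected. For a real number $t\ge 0$, $G$ is $t$-tough if $|S|\ge t\cdot\omega(G-S)$ for every vertex cut $S$ of $G$. Let $P_2\cup kP_1$ be the graph consisting of one edge and $k$ isolated vertices; $G$ is $(P_2\cup kP_1)$-free if it has no induced subgraph isomorphic to $P_2\cup kP_1$. $G$ is hamiltonian if it contains a cycle through all of its vertices. Let $k\ge 3$ be an integer and let $G$ be a $\frac{7k-6}{10}$-tough $(P_2\cup kP_1)$-free graph on at least three vertices. Then $G$ is hamiltonian or $G$ is isomorphic to the Petersen graph. -/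

import Mathlib

namespace SimpleGraph

/-- `S` is a vertex cut of `G` when `G - S` is disconnected, that is, has at least two components. -/
def IsVertexCut {V : Type*} (G : SimpleGraph V) (S : Finset V) : Prop :=
  ¬ (G.induce (S : Set V)ᶜ).Preconnected

/-- `ω(G)`, the number of components of a finite graph `G`. -/
noncomputable def numComponents {V : Type*} (G : SimpleGraph V) : ℕ :=
  Nat.card G.ConnectedComponent

/-- A finite graph `G` is `t`-tough when `|S| ≥ t * ω(G - S)` for every vertex cut `S`. -/
def IsTough {V : Type*} [Finite V] (G : SimpleGraph V) (t : ℝ) : Prop :=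
  ∀ S : Finset V, G.IsVertexCut S →
    t * ((G.induce (S : Set V)ᶜ).numComponents : ℝ) ≤ (S.card : ℝ)

/-- `G` is `H`-free when no induced subgraph of `G` is isomorphic to `H`. -/
def IsInducedFree {V W : Type*} (G : SimpleGraph V) (H : SimpleGraph W) : Prop :=
  ¬ H.IsIndContained G

/-- `P₂ ∪ k P₁`: the disjoint union of one edge and `k` isolated vertices. -/
def edgeUnionIsolated (k : ℕ) : SimpleGraph (Fin 2 ⊕ Fin k) :=
  SimpleGraph.sum (⊤ : SimpleGraph (Fin 2)) (⊥ : SimpleGraph (Fin k))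

/-- The Petersen graph: its vertices are the 2-element subsets of a 5-element set, and two of them
are adjacent exactly when they are disjoint. -/
def petersenGraph : SimpleGraph {s : Finset (Fin 5) // s.card = 2} :=
  SimpleGraph.fromRel fun s t => Disjoint s.1 t.1

end SimpleGraph

/-! Suppose a longest cycle $C$ misses a vertex $x$, and put $t=(7k-6)/10$, so $2t\ge k$. A
component of $G-C$ has at least $2t\ge k$ neighbours on $C$, and their successors are independent
and not adjacent to it. An edge in that component would therefore give $P_2\cup kP_1$, so the
vertices off $C$ are independent (`not_adj_of_off`).

Let $d\ge 2t$ be the degree of $x$, and let $A$ consist of $x$ and the $d$ successors of its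
neighbours. $A$ is independent, so a vertex with one neighbour in $A$ misses at most $k-1$ vertices
of $A$ and has at least $d+2-k\ge 2$ neighbours there. Let $R$ be the set of such vertices and $Z$
its complement. $Z$ is independent, since an edge in $Z$ together with $A$ would contain $P_2\cup
kP_1$; toughness then gives $|R|\ge t|Z|$. All of $R$ lies on $C$, while $x\in Z$ does not.

By rerouting $C$, up to four consecutive vertices of $C$ that all lie in $R$ have pairwise disjoint
neighbourhoods in $A$ (`not_adj_of_adj_succ`, `not_adj_of_adj_add_two`, `not_adj_of_adj_add_three`).
A run of $r+1\le 4$ of them thus needs $(r+1)(d+2-k)\le d+1$. If there is no such run, then $|R|\le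
r(|Z|-1)$ (`card_le_mul_card`). Comparison with $|R|\ge t|Z|$ leaves only $k=3$, $d=3$, where $G$ is
forced to contain a spanning Petersen graph. A cut of four vertices leaving three components then
contradicts $3/2$-toughness. The Petersen alternative thus never occurs. -/

namespace SimpleGraph

/-! ### Paths with prescribed vertex set, and longest cycles. -/

section Paths

variable {V : Type*} [DecidableEq V] {G : SimpleGraph V}

/-- There is a path of `G` from `a` to `b` whose vertex set is `s`. -/
def HasPathOn (G : SimpleGraph V) (s : Finset V) (a b : V) : Prop :=
  ∃ p : G.Walk a b, p.IsPath ∧ p.support.toFinset = s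

theorem HasPathOn.singleton (a : V) : G.HasPathOn {a} a a :=
  ⟨.nil, by simp, by simp⟩

theorem HasPathOn.symm {s : Finset V} {a b : V} (h : G.HasPathOn s a b) : G.HasPathOn s b a := by
  obtain ⟨p, hp, rfl⟩ := h
  exact ⟨p.reverse, hp.reverse, by simp⟩

theorem HasPathOn.left_mem {s : Finset V} {a b : V} (h : G.HasPathOn s a b) : a ∈ s := by
  obtain ⟨p, hp, rfl⟩ := h
  simp

theorem HasPathOn.append {s s' : Finset V} {a b a' b' : V} (h : G.HasPathOn s a b)
    (h' : G.HasPathOn s' a' b') (hd : Disjoint s s') (hadj : G.Adj b a') :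
    G.HasPathOn (s ∪ s') a b' := by
  obtain ⟨p, hp, rfl⟩ := h
  obtain ⟨q, hq, rfl⟩ := h'
  refine ⟨p.append (.cons hadj q), ?_, ?_⟩
  · rw [Walk.isPath_def, Walk.support_append, Walk.support_cons, List.tail_cons]
    rw [List.disjoint_toFinset_iff_disjoint] at hd
    exact List.Nodup.append hp.support_nodup hq.support_nodup hd
  · rw [Walk.support_append, Walk.support_cons, List.tail_cons, List.toFinset_append]

theorem isHamiltonian_of_hasPathOn_univ [Fintype V] {a b : V} (hV : 3 ≤ Fintype.card V)
    (h : G.HasPathOn Finset.univ a b) (hadj : G.Adj b a) : G.IsHamiltonian := by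
  obtain ⟨p, hp, hs⟩ := h
  have hlen : p.length + 1 = Fintype.card V := by
    rw [← Walk.length_support, ← List.toFinset_card_of_nodup hp.support_nodup, hs,
      Finset.card_univ]
  intro _
  refine ⟨b, .cons hadj p, ?_⟩
  rw [Walk.isHamiltonianCycle_iff_isCycle_and_length_eq]
  refine ⟨?_, by simpa using hlen⟩
  rw [Walk.cons_isCycle_iff]
  refine ⟨hp, fun he => ?_⟩
  have := hp.length_eq_one_of_mem_edges (Sym2.eq_swap ▸ he)
  omega

/-- `c` runs periodically, with period `N`, through the vertices of a longest cycle of `G`. (An edge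
counts as a cycle of length two.) -/
structure IsLongestCycle (G : SimpleGraph V) (c : ℕ → V) (N : ℕ) : Prop where
  two_le : 2 ≤ N
  periodic : ∀ i, c (i + N) = c i
  ne : ∀ i j, i < j → j < i + N → c i ≠ c j
  adj : ∀ i, G.Adj (c i) (c (i + 1))
  -- Maximality is phrased for a path with adjacent ends, so an exchange argument only has to glue
  -- arcs and name the closing edge.
  card_le : ∀ s a b, G.HasPathOn s a b → G.Adj b a → s.card ≤ N

theorem exists_isLongestCycle [Fintype V] {u v : V} (huv : G.Adj u v) :
    ∃ c N, G.IsLongestCycle c N := by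
  classical
  let P : ℕ → Prop := fun n => ∃ s a b, G.HasPathOn s a b ∧ G.Adj b a ∧ s.card = n
  have hP2 : P 2 := by
    refine ⟨{u} ∪ {v}, u, v, ?_, huv.symm, ?_⟩
    · exact (HasPathOn.singleton u).append (HasPathOn.singleton v) (by simp [huv.ne]) huv
    · rw [Finset.card_union_of_disjoint (by simp [huv.ne])]; simp
  have hbound : ∀ n, P n → n ≤ Fintype.card V := by
    rintro n ⟨s, a, b, -, -, rfl⟩
    exact Finset.card_le_univ s
  obtain ⟨s, a, b, ⟨p, hp, hs⟩, hba, hN⟩ := Nat.findGreatest_spec (hbound 2 hP2) hP2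
  have h2 := Nat.le_findGreatest (hbound 2 hP2) hP2
  have hmax : ∀ n, P n → n ≤ Nat.findGreatest P (Fintype.card V) :=
    fun n hn => Nat.le_findGreatest (hbound n hn) hn
  set N := Nat.findGreatest P (Fintype.card V)
  have hlen : p.length + 1 = N := by
    rw [← hN, ← hs, List.toFinset_card_of_nodup hp.support_nodup, Walk.length_support]
  refine ⟨fun i => p.getVert (i % N), N, h2, fun i => by simp, ?_, ?_,
    fun s a b h hadj => hmax _ ⟨s, a, b, h, hadj, rfl⟩⟩
  · intro i j hij hji h
    have hi := Nat.mod_lt i (show 0 < N by omega)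
    have hj := Nat.mod_lt j (show 0 < N by omega)
    have := hp.getVert_injOn (show i % N ≤ p.length by omega) (show j % N ≤ p.length by omega) h
    have h3 : (j - i) % N = 0 := Nat.sub_mod_eq_zero_of_mod_eq this.symm
    rw [Nat.mod_eq_of_lt (by omega)] at h3
    omega
  · intro i
    have hi := Nat.mod_lt i (show 0 < N by omega)
    by_cases h : i % N + 1 = N
    · have h1 : (i + 1) % N = 0 := by
        rw [← Nat.mod_add_mod, h, Nat.mod_self]
      rw [h1, Walk.getVert_zero, show i % N = p.length by omega, Walk.getVert_length]
      exact hba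
    · have h1 : (i + 1) % N = i % N + 1 := by
        rw [← Nat.mod_add_mod, Nat.mod_eq_of_lt (by omega)]
      rw [h1]
      exact p.adj_getVert_succ (by omega)

end Paths

/-! ### Toughness in terms of labelled parts. -/

section Toughness

variable {V : Type*} [Fintype V] {G : SimpleGraph V}

/-- If `G - S` splits into at least two nonempty parts with no edges between different parts, then
a `t`-tough graph `G` has at least `t` times as many vertices in `S` as there are parts. -/
theorem IsTough.mul_card_le {t : ℝ} (ht : 0 ≤ t) (h : G.IsTough t) {ι : Type*} [Fintype ι]
    (hι : 2 ≤ Fintype.card ι) (S : Finset V) (f : V → ι)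
    (hf : ∀ a b, a ∉ S → b ∉ S → G.Adj a b → f a = f b) (hsurj : ∀ i, ∃ a, a ∉ S ∧ f a = i) :
    t * Fintype.card ι ≤ S.card := by
  classical
  let g : ((S : Set V)ᶜ : Set V) → ι := fun a => f a
  have hg : ∀ a b, (G.induce (S : Set V)ᶜ).Reachable a b → g a = g b := by
    rintro a b ⟨p⟩
    induction p with
    | nil => rfl
    | @cons a b _ hadj _ ih =>
      refine (hf _ _ ?_ ?_ hadj).trans ih
      · exact fun h => a.2 (Finset.mem_coe.2 h)
      · exact fun h => b.2 (Finset.mem_coe.2 h)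
  have hcut : G.IsVertexCut S := by
    intro hpre
    obtain ⟨i, j, hij⟩ := Fintype.one_lt_card_iff.1 (show 1 < Fintype.card ι by omega)
    obtain ⟨a, ha, rfl⟩ := hsurj i
    obtain ⟨b, hb, rfl⟩ := hsurj j
    exact hij (hg ⟨a, by simpa using ha⟩ ⟨b, by simpa using hb⟩ (hpre _ _))
  refine le_trans ?_ (h S hcut)
  refine mul_le_mul_of_nonneg_left ?_ ht
  rw [numComponents, ← Nat.card_eq_fintype_card]
  norm_cast
  refine Nat.card_le_card_of_surjective
    (ConnectedComponent.lift g fun a b p _ => hg a b ⟨p⟩) fun i => ?_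
  obtain ⟨a, ha, rfl⟩ := hsurj i
  exact ⟨connectedComponentMk _ ⟨a, by simpa using ha⟩, rfl⟩

end Toughness

/-! ### Independent sets in a $(P_2\cup kP_1)$-free graph. -/

section Free

variable {V : Type*} {G : SimpleGraph V}

theorem IsInducedFree.card_lt {k : ℕ} (h : G.IsInducedFree (edgeUnionIsolated k)) {u v : V}
    (huv : G.Adj u v) (I : Finset V) (hI : ∀ a ∈ I, ∀ b ∈ I, ¬ G.Adj a b)
    (hIu : ∀ a ∈ I, a ≠ u ∧ ¬ G.Adj u a) (hIv : ∀ a ∈ I, a ≠ v ∧ ¬ G.Adj v a) : I.card < k := by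
  by_contra! hk
  obtain ⟨J, hJ, hJk⟩ := Finset.exists_subset_card_eq hk
  let e : Fin k ≃ J := (Finset.equivFinOfCardEq hJk).symm
  have he : ∀ i, (e i : V) ∈ I := fun i => hJ (e i).2
  refine h ⟨⟨⟨Sum.elim ![u, v] fun i => (e i : V), ?_⟩, ?_⟩⟩
  · rintro (i | i) (j | j) hij
    · fin_cases i <;> fin_cases j <;> simp_all [huv.ne, huv.ne']
    · fin_cases i <;> simp at hij
      · exact absurd hij.symm (hIu _ (he j)).1
      · exact absurd hij.symm (hIv _ (he j)).1
    · fin_cases j <;> simp at hij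
      · exact absurd hij (hIu _ (he i)).1
      · exact absurd hij (hIv _ (he i)).1
    · simpa [Subtype.ext_iff] using hij
  · intro i j
    change G.Adj (Sum.elim ![u, v] (fun i => (e i : V)) i)
      (Sum.elim ![u, v] (fun i => (e i : V)) j) ↔ _
    rcases i with i | i <;> rcases j with j | j
    · fin_cases i <;> fin_cases j <;> simp [edgeUnionIsolated, huv, huv.symm]
    · fin_cases i <;> simp [edgeUnionIsolated, (hIu _ (he j)).2, (hIv _ (he j)).2]
    · fin_cases j <;> simp [edgeUnionIsolated, G.adj_comm (e i), (hIu _ (he i)).2, (hIv _ (he i)).2]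
    · simp [edgeUnionIsolated, hI _ (he i) _ (he j)]

open scoped Classical in
/-- A vertex with a neighbour in an independent set misses fewer than `k` of its vertices. -/
theorem IsInducedFree.card_lt_card_filter_add {k : ℕ}
    (h : G.IsInducedFree (edgeUnionIsolated k)) (I : Finset V)
    (hI : ∀ a ∈ I, ∀ b ∈ I, ¬ G.Adj a b) {u w : V} (hw : w ∈ I) (huw : G.Adj u w) :
    I.card < (I.filter (G.Adj u)).card + k := by
  have h1 : (I.filter fun a => ¬ G.Adj u a).card < k := by
    refine h.card_lt huw _ ?_ ?_ ?_
    · intro a ha b hb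
      exact hI a (Finset.mem_filter.1 ha).1 b (Finset.mem_filter.1 hb).1
    · intro a ha
      obtain ⟨ha, hau⟩ := Finset.mem_filter.1 ha
      exact ⟨fun h => hI a ha w hw (h ▸ huw), hau⟩
    · intro a ha
      obtain ⟨ha, hau⟩ := Finset.mem_filter.1 ha
      exact ⟨fun h => hau (h ▸ huw), hI w hw a ha⟩
  have := Finset.card_filter_add_card_filter_not (s := I) (G.Adj u)
  omega

end Free

end SimpleGraph

namespace SimpleGraph

/-! ### Rerouting a longest cycle. -/

section LongestCycle

variable {V : Type*} [DecidableEq V] {G : SimpleGraph V} {c : ℕ → V} {N : ℕ}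

namespace IsLongestCycle

theorem shift (h : G.IsLongestCycle c N) (k : ℕ) : G.IsLongestCycle (fun i => c (i + k)) N where
  two_le := h.two_le
  periodic i := by rw [← h.periodic (i + k)]; congr 1; omega
  ne i j hij hji := h.ne _ _ (by omega) (by omega)
  adj i := by
    have := h.adj (i + k)
    rwa [show i + k + 1 = i + 1 + k by omega] at this
  card_le := h.card_le

theorem periodic_mul (h : G.IsLongestCycle c N) (i m : ℕ) : c (i + N * m) = c i := by
  induction m with
  | zero => simp
  | succ m ih => rw [Nat.mul_succ, ← add_assoc, h.periodic, ih]

theorem apply_mod (h : G.IsLongestCycle c N) (i : ℕ) : c (i % N) = c i := by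
  conv_rhs => rw [← Nat.mod_add_div i N]
  rw [h.periodic_mul]

/-- Every vertex of the cycle has an index in any prescribed window of length `N`. -/
theorem exists_index (h : G.IsLongestCycle c N) (i j : ℕ) :
    ∃ l, j ≤ l ∧ l < j + N ∧ c l = c i := by
  have hN := h.two_le
  -- Adding the multiple `N * j` of the period keeps the subtraction of `j` from truncating.
  have h1 := Nat.mod_lt (i + N * j - j) (show 0 < N by omega)
  refine ⟨j + (i + N * j - j) % N, by omega, by omega, ?_⟩
  have h2 : j ≤ N * j := Nat.le_mul_of_pos_left j (by omega)
  rw [← h.periodic_mul i j]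
  conv_rhs => rw [show i + N * j = j + (i + N * j - j) by omega,
    ← Nat.mod_add_div (i + N * j - j) N, ← add_assoc, h.periodic_mul]

theorem eq_of_apply_eq (h : G.IsLongestCycle c N) {i j : ℕ} (hij : c i = c j) (h1 : i < j + N)
    (h2 : j < i + N) : i = j := by
  rcases lt_trichotomy i j with h3 | h3 | h3
  · exact absurd hij (h.ne i j h3 h2)
  · exact h3
  · exact absurd hij.symm (h.ne j i h3 h1)

theorem apply_succ_eq (h : G.IsLongestCycle c N) {i j : ℕ} (hij : c i = c j) :
    c (i + 1) = c (j + 1) := by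
  have hN := h.two_le
  have h1 : i % N = j % N := by
    have hi := Nat.mod_lt i (show 0 < N by omega)
    have hj := Nat.mod_lt j (show 0 < N by omega)
    rw [← h.apply_mod i, ← h.apply_mod j] at hij
    exact h.eq_of_apply_eq hij (by omega) (by omega)
  rw [← h.apply_mod (i + 1), ← h.apply_mod (j + 1), Nat.add_mod, h1, ← Nat.add_mod]

/-- A predecessor is reached by going `N - 1` steps further round the cycle. -/
theorem eq_of_apply_succ_eq (h : G.IsLongestCycle c N) {i j : ℕ} (hij : c (i + 1) = c (j + 1)) :
    c i = c j := by
  have hN := h.two_le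
  have key : ∀ m, c (i + 1 + m) = c (j + 1 + m) := by
    intro m
    induction m with
    | zero => exact hij
    | succ m ih => exact h.apply_succ_eq ih
  have := key (N - 1)
  rwa [show i + 1 + (N - 1) = i + N by omega, show j + 1 + (N - 1) = j + N by omega,
    h.periodic, h.periodic] at this

theorem hasPathOn_arc (h : G.IsLongestCycle c N) {i j : ℕ} (hij : i ≤ j) (hji : j < i + N) :
    G.HasPathOn ((Finset.Icc i j).image c) (c i) (c j) := by
  induction j, hij using Nat.le_induction with
  | base => simpa using HasPathOn.singleton (G := G) (c i)
  | succ j hij ih =>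
    have hd : Disjoint ((Finset.Icc i j).image c) {c (j + 1)} := by
      simp only [Finset.disjoint_singleton_right, Finset.mem_image, Finset.mem_Icc, not_exists,
        not_and]
      rintro l ⟨hl1, hl2⟩
      exact h.ne l (j + 1) (by omega) (by omega)
    have := (ih (by omega)).append (HasPathOn.singleton _) hd (h.adj j)
    convert this using 1
    rw [← Finset.insert_Icc_right_eq_Icc_add_one (by omega), Finset.image_insert,
      Finset.union_comm]
    rfl

theorem card_arc (h : G.IsLongestCycle c N) {i j : ℕ} (hji : j < i + N) :
    ((Finset.Icc i j).image c).card = j + 1 - i := by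
  rw [Finset.card_image_of_injOn, Nat.card_Icc]
  intro l hl m hm hlm
  simp only [Finset.coe_Icc, Set.mem_Icc] at hl hm
  exact h.eq_of_apply_eq hlm (by omega) (by omega)

theorem disjoint_arc (h : G.IsLongestCycle c N) {i j i' j' : ℕ} (hji : j < i')
    (hj' : j' < i + N) :
    Disjoint ((Finset.Icc i j).image c) ((Finset.Icc i' j').image c) := by
  rw [Finset.disjoint_left]
  simp only [Finset.mem_image, Finset.mem_Icc]
  rintro _ ⟨l, hl, rfl⟩ ⟨m, hm, hlm⟩
  exact h.ne l m (by omega) (by omega) hlm.symm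

theorem disjoint_arc_of_forall {s : Finset V} (hs : ∀ i, c i ∉ s) (i j : ℕ) :
    Disjoint ((Finset.Icc i j).image c) s := by
  rw [Finset.disjoint_left]
  simp only [Finset.mem_image, Finset.mem_Icc]
  rintro _ ⟨l, hl, rfl⟩
  exact hs l

theorem disjoint_arc_singleton {x : V} (hx : ∀ i, c i ≠ x) (i j : ℕ) :
    Disjoint ((Finset.Icc i j).image c) {x} :=
  disjoint_arc_of_forall (fun i => by simpa using hx i) i j

/-- An arc of the cycle into which a vertex `z` outside the arc has been inserted. -/
theorem hasPathOn_insert_arc (h : G.IsLongestCycle c N) {i j l : ℕ} {z : V} (hil : i ≤ l)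
    (hlj : l + 1 ≤ j) (hji : j < i + N) (hz : z ∉ (Finset.Icc i j).image c)
    (h1 : G.Adj z (c l)) (h2 : G.Adj z (c (l + 1))) :
    G.HasPathOn (insert z ((Finset.Icc i j).image c)) (c i) (c j) := by
  have hd1 : Disjoint ((Finset.Icc i l).image c) {z} := by
    rw [Finset.disjoint_singleton_right]
    exact fun hm => hz (Finset.image_subset_image (Finset.Icc_subset_Icc le_rfl (by omega)) hm)
  have hd2 : Disjoint ((Finset.Icc i l).image c ∪ {z}) ((Finset.Icc (l + 1) j).image c) := by
    rw [Finset.disjoint_union_left, Finset.disjoint_singleton_left]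
    exact ⟨h.disjoint_arc (by omega) (by omega), fun hm => hz
      (Finset.image_subset_image (Finset.Icc_subset_Icc (by omega) le_rfl) hm)⟩
  have := ((h.hasPathOn_arc hil (by omega)).append (.singleton z) hd1 h1.symm).append
    (h.hasPathOn_arc hlj (by omega)) hd2 h2
  convert this using 1
  ext y
  simp only [Finset.mem_insert, Finset.mem_union, Finset.mem_image, Finset.mem_Icc,
    Finset.mem_singleton]
  constructor
  · rintro (rfl | ⟨m, hm, rfl⟩)
    · simp
    · by_cases hml : m ≤ l
      · exact .inl (.inl ⟨m, by omega, rfl⟩)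
      · exact .inr ⟨m, by omega, rfl⟩
  · rintro ((⟨m, hm, rfl⟩ | rfl) | ⟨m, hm, rfl⟩)
    · exact .inr ⟨m, by omega, rfl⟩
    · simp
    · exact .inr ⟨m, by omega, rfl⟩

/-- A path off a longest cycle does not join two consecutive vertices of the cycle. -/
theorem not_adj_succ (h : G.IsLongestCycle c N) {s : Finset V} {u v : V}
    (hs : G.HasPathOn s u v) (hd : ∀ i, c i ∉ s) {i : ℕ} (hu : G.Adj u (c i)) :
    ¬ G.Adj v (c (i + 1)) := by
  intro hv
  have hN := h.two_le
  have hdis := disjoint_arc_of_forall hd (i + 1) (i + N)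
  have hp := (h.hasPathOn_arc (i := i + 1) (j := i + N) (by omega) (by omega)).append hs hdis
    (by rw [h.periodic]; exact hu.symm)
  have h1 := h.card_le _ _ _ hp hv
  rw [Finset.card_union_of_disjoint hdis, h.card_arc (by omega)] at h1
  have := Finset.card_pos.2 ⟨u, hs.left_mem⟩
  omega

/-- If a path off a longest cycle joins two vertices of the cycle, then their successors are not
adjacent. -/
theorem not_adj_succ_succ (h : G.IsLongestCycle c N) {s : Finset V} {u v : V}
    (hs : G.HasPathOn s u v) (hd : ∀ i, c i ∉ s) {i j : ℕ} (hij : i < j) (hji : j < i + N)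
    (hu : G.Adj u (c i)) (hv : G.Adj v (c j)) : ¬ G.Adj (c (i + 1)) (c (j + 1)) := by
  intro hadj
  have hd1 := disjoint_arc_of_forall hd (i + 1) j
  have hd2 := disjoint_arc_of_forall hd (j + 1) (i + N)
  have hd3 := h.disjoint_arc (i := i + 1) (j := j) (i' := j + 1) (j' := i + N) (by omega)
    (by omega)
  have hd4 := Finset.disjoint_union_left.2 ⟨hd3, hd2.symm⟩
  -- The longer cycle runs `c (i+1) … c j`, back along `s` from `v` to `u`, then `c i` backwards to
  -- `c (j+1)`.
  have hp := ((h.hasPathOn_arc (i := i + 1) (j := j) (by omega) (by omega)).append hs.symm hd1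
    hv.symm).append (h.hasPathOn_arc (i := j + 1) (j := i + N) (by omega) (by omega)).symm hd4
    (by rw [h.periodic]; exact hu)
  have h1 := h.card_le _ _ _ hp hadj.symm
  rw [Finset.card_union_of_disjoint hd4, Finset.card_union_of_disjoint hd1,
    h.card_arc (by omega), h.card_arc (by omega)] at h1
  have := Finset.card_pos.2 ⟨u, hs.left_mem⟩
  omega

/-- Two vertices `x`, `y` off a longest cycle: `y` has at most one neighbour among the successors of
the neighbours of `x`. -/
theorem not_adj_two_succ (h : G.IsLongestCycle c N) {x y : V} (hx : ∀ i, c i ≠ x)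
    (hy : ∀ i, c i ≠ y) (hxy : x ≠ y) {i j : ℕ} (hij : i < j) (hji : j < i + N)
    (hxi : G.Adj x (c i)) (hxj : G.Adj x (c j)) (hyi : G.Adj y (c (i + 1))) :
    ¬ G.Adj y (c (j + 1)) := by
  intro hadj
  have hd1 := disjoint_arc_singleton hx (i + 1) j
  have hd2 := disjoint_arc_singleton hx (j + 1) (i + N)
  have hd1' := disjoint_arc_singleton hy (i + 1) j
  have hd2' := disjoint_arc_singleton hy (j + 1) (i + N)
  have hd3 := h.disjoint_arc (i := i + 1) (j := j) (i' := j + 1) (j' := i + N) (by omega)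
    (by omega)
  have hd4 := Finset.disjoint_union_left.2 ⟨hd3, hd2.symm⟩
  have hd5 : Disjoint ((Finset.Icc (i + 1) j).image c ∪ {x} ∪ (Finset.Icc (j + 1) (i + N)).image c)
      {y} := Finset.disjoint_union_left.2
        ⟨Finset.disjoint_union_left.2 ⟨hd1', by simpa using hxy⟩, hd2'⟩
  have hp := (((h.hasPathOn_arc (i := i + 1) (j := j) (by omega) (by omega)).append
    (.singleton x) hd1 hxj.symm).append
    (h.hasPathOn_arc (i := j + 1) (j := i + N) (by omega) (by omega)).symm hd4
    (by rw [h.periodic]; exact hxi)).append (.singleton y) hd5 hadj.symm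
  have h1 := h.card_le _ _ _ hp hyi
  rw [Finset.card_union_of_disjoint hd5, Finset.card_union_of_disjoint hd4,
    Finset.card_union_of_disjoint hd1, h.card_arc (by omega), h.card_arc (by omega),
    Finset.card_singleton, Finset.card_singleton] at h1
  omega

/-- Otherwise `c (j+1) … c p, x, c q … c (p+1), c j … c (q+1)`, with the last two arcs run
backwards, is a longer cycle. Hence, in the order along the cycle, no neighbour of `c (j+1)` among
the successors comes after one of `c j`. -/
theorem not_crossing (h : G.IsLongestCycle c N) {x : V} (hx : ∀ i, c i ≠ x) {j p q : ℕ}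
    (hjp : j + 1 ≤ p) (hpq : p < q) (hq : q < j + N) (hxp : G.Adj x (c p)) (hxq : G.Adj x (c q))
    (hp : G.Adj (c j) (c (p + 1))) : ¬ G.Adj (c (j + 1)) (c (q + 1)) := by
  intro hadj
  have hdx := disjoint_arc_singleton hx
  have hd1 := hdx (j + 1) p
  have hd2 : Disjoint ((Finset.Icc (j + 1) p).image c ∪ {x}) ((Finset.Icc (p + 1) q).image c) :=
    Finset.disjoint_union_left.2 ⟨h.disjoint_arc (by omega) (by omega), (hdx _ _).symm⟩
  have hd3 : Disjoint ((Finset.Icc (j + 1) p).image c ∪ {x} ∪ (Finset.Icc (p + 1) q).image c)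
      ((Finset.Icc (q + 1) (j + N)).image c) :=
    Finset.disjoint_union_left.2 ⟨Finset.disjoint_union_left.2
      ⟨h.disjoint_arc (by omega) (by omega), (hdx _ _).symm⟩, h.disjoint_arc (by omega) (by omega)⟩
  have hP := (((h.hasPathOn_arc hjp (by omega)).append (.singleton x) hd1 hxp.symm).append
    (h.hasPathOn_arc (i := p + 1) (j := q) (by omega) (by omega)).symm hd2 hxq).append
    (h.hasPathOn_arc (i := q + 1) (j := j + N) (by omega) (by omega)).symm hd3
    (by rw [h.periodic]; exact hp.symm)
  have h1 := h.card_le _ _ _ hP hadj.symm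
  rw [Finset.card_union_of_disjoint hd3, Finset.card_union_of_disjoint hd2,
    Finset.card_union_of_disjoint hd1, h.card_arc (by omega), h.card_arc (by omega),
    h.card_arc (by omega), Finset.card_singleton] at h1
  omega

section Insertion

variable {x : V} {i j : ℕ}

/-- If the successor `c (i + 1)` of a neighbour of `x` can be inserted between two other consecutive
vertices of the cycle, then the next vertex `c (i + 2)` is not adjacent to `x`. -/
theorem not_adj_of_insertable (h : G.IsLongestCycle c N) (hx : ∀ i, c i ≠ x) (hij : i + 2 ≤ j)
    (hji : j + 1 ≤ i + N) (hxi : G.Adj x (c i)) (h1 : G.Adj (c (i + 1)) (c j))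
    (h2 : G.Adj (c (i + 1)) (c (j + 1))) : ¬ G.Adj x (c (i + 2)) := by
  intro hadj
  have hz : c (i + 1) ∉ (Finset.Icc (i + 2) (i + N)).image c := by
    simp only [Finset.mem_image, Finset.mem_Icc, not_exists, not_and]
    exact fun l hl he => h.ne (i + 1) l (by omega) (by omega) he.symm
  have hd : Disjoint (insert (c (i + 1)) ((Finset.Icc (i + 2) (i + N)).image c)) {x} := by
    rw [Finset.disjoint_singleton_right, Finset.mem_insert]
    rintro (he | he)
    · exact hx _ he.symm
    · obtain ⟨l, -, he⟩ := Finset.mem_image.1 he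
      exact hx _ he
  -- `x` takes the place of `c (i+1)`, which moves between `c j` and `c (j+1)`.
  have hP := (h.hasPathOn_insert_arc hij hji (by omega) hz h1 h2).append (.singleton x) hd
    (by rw [h.periodic]; exact hxi.symm)
  have h3 := h.card_le _ _ _ hP hadj
  rw [Finset.card_union_of_disjoint hd, Finset.card_insert_of_notMem hz, h.card_arc (by omega),
    Finset.card_singleton] at h3
  omega

/-- If the successor `c (i + 1)` of a neighbour of `x` can be inserted between two other consecutive
vertices of the cycle, then the next vertex `c (i + 2)` is not adjacent to the successor of another
neighbour of `x`. -/
theorem not_adj_succ_of_insertable (h : G.IsLongestCycle c N) (hx : ∀ i, c i ≠ x)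
    (hij : i + 2 ≤ j) (hji : j + 1 ≤ i + N) (hxi : G.Adj x (c i)) (h1 : G.Adj (c (i + 1)) (c j))
    (h2 : G.Adj (c (i + 1)) (c (j + 1))) {l : ℕ} (hil : i + 2 ≤ l) (hli : l < i + N) (hlj : l ≠ j)
    (hxl : G.Adj x (c l)) : ¬ G.Adj (c (i + 2)) (c (l + 1)) := by
  intro hadj
  have hz : ∀ a b, i + 2 ≤ a → b ≤ i + N → c (i + 1) ∉ (Finset.Icc a b).image c := by
    intro a b ha hb
    simp only [Finset.mem_image, Finset.mem_Icc, not_exists, not_and]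
    exact fun l hl he => h.ne (i + 1) l (by omega) (by omega) he.symm
  have hdx := disjoint_arc_singleton hx
  have hxz : Disjoint {c (i + 1)} ({x} : Finset V) := by simpa using hx (i + 1)
  have hd : Disjoint ((Finset.Icc (i + 2) l).image c) ((Finset.Icc (l + 1) (i + N)).image c) :=
    h.disjoint_arc (by omega) (by omega)
  -- The new cycle joins the arcs `c (i+2) … c l` and `c (l+1) … c (i+N)` through `x`. The edge
  -- receiving `c (i+1)` survives because `l ≠ j`; the cases say which arc contains it.
  rcases lt_or_gt_of_ne hlj with hlt | hlt
  · have hz1 := hz (l + 1) (i + N) (by omega) (by omega)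
    have hd1 := hdx (i + 2) l
    have hd2 : Disjoint ((Finset.Icc (i + 2) l).image c ∪ {x})
        (insert (c (i + 1)) ((Finset.Icc (l + 1) (i + N)).image c)) := by
      rw [Finset.insert_eq, Finset.disjoint_union_left, Finset.disjoint_union_right,
        Finset.disjoint_union_right]
      exact ⟨⟨Finset.disjoint_singleton_right.2 (hz _ _ (by omega) (by omega)), hd⟩, hxz.symm,
        (hdx _ _).symm⟩
    have hP := ((h.hasPathOn_arc hil (by omega)).append (.singleton x) hd1 hxl.symm).append
      (h.hasPathOn_insert_arc (i := l + 1) (by omega) hji (by omega) hz1 h1 h2).symm hd2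
      (by rw [h.periodic]; exact hxi)
    have h3 := h.card_le _ _ _ hP hadj.symm
    rw [Finset.card_union_of_disjoint hd2, Finset.card_union_of_disjoint hd1,
      Finset.card_insert_of_notMem hz1, h.card_arc (by omega), h.card_arc (by omega),
      Finset.card_singleton] at h3
    omega
  · have hz1 := hz (i + 2) l (by omega) (by omega)
    have hd1 : Disjoint (insert (c (i + 1)) ((Finset.Icc (i + 2) l).image c)) {x} := by
      rw [Finset.insert_eq, Finset.disjoint_union_left]
      exact ⟨hxz, hdx _ _⟩
    have hd2 : Disjoint (insert (c (i + 1)) ((Finset.Icc (i + 2) l).image c) ∪ {x})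
        ((Finset.Icc (l + 1) (i + N)).image c) := by
      rw [Finset.insert_eq, Finset.disjoint_union_left, Finset.disjoint_union_left]
      exact ⟨⟨Finset.disjoint_singleton_left.2 (hz _ _ (by omega) (by omega)), hd⟩,
        (hdx _ _).symm⟩
    have hP := ((h.hasPathOn_insert_arc hij (by omega) (by omega) hz1 h1 h2).append (.singleton x)
      hd1 hxl.symm).append (h.hasPathOn_arc (i := l + 1) (j := i + N) (by omega) (by omega)).symm hd2
      (by rw [h.periodic]; exact hxi)
    have h3 := h.card_le _ _ _ hP hadj.symm
    rw [Finset.card_union_of_disjoint hd2, Finset.card_union_of_disjoint hd1,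
      Finset.card_insert_of_notMem hz1, h.card_arc (by omega), h.card_arc (by omega),
      Finset.card_singleton] at h3
    omega

end Insertion

end IsLongestCycle

end LongestCycle

end SimpleGraph

namespace SimpleGraph

/-! ### Counting on the cycle, and independence of the vertices off it. -/

section LongestCycle

variable {V : Type*} [DecidableEq V] {G : SimpleGraph V} {c : ℕ → V} {N : ℕ}

namespace IsLongestCycle

theorem apply_mod_add (h : G.IsLongestCycle c N) (i m : ℕ) : c (i % N + m) = c (i + m) := by
  rw [← h.apply_mod, Nat.mod_add_mod, h.apply_mod]

theorem exists_lt (h : G.IsLongestCycle c N) (i : ℕ) : ∃ l < N, c l = c i :=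
  ⟨i % N, Nat.mod_lt _ (by have := h.two_le; omega), h.apply_mod i⟩

theorem injOn_range_add (h : G.IsLongestCycle c N) (m : ℕ) :
    Set.InjOn (fun i => c (i + m)) (Finset.range N) := by
  intro i hi j hj hij
  simp only [Finset.coe_range, Set.mem_Iio] at hi hj
  have := h.eq_of_apply_eq hij (by omega) (by omega)
  omega

/-- A vertex set `Z` meeting every set of `r + 1` consecutive vertices of the cycle contains at least
one `r`-th of the remaining vertices of the cycle. -/
theorem card_le_mul_card (h : G.IsLongestCycle c N) {Z R : Finset V} {r : ℕ}
    (hR : ∀ v ∈ R, v ∉ Z ∧ ∃ i, c i = v) (hrun : ∀ j, ∃ e ≤ r, c (j + e) ∈ Z) :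
    R.card ≤ r * ((Finset.range N).filter fun i => c i ∈ Z).card := by
  set I := (Finset.range N).filter fun i => c i ∈ Z
  -- The `r + 1` consecutive vertices ending at a vertex of `R` meet `Z`, but not at the end, so
  -- that vertex comes between 1 and `r` steps after one in `Z`.
  have hsub : R ⊆ (Finset.Icc 1 r).biUnion fun m => I.image fun i => c (i + m) := by
    intro v hv
    obtain ⟨hvZ, i, rfl⟩ := hR v hv
    obtain ⟨l, hl, -, hli⟩ := h.exists_index i r
    rw [← hli] at hvZ ⊢
    obtain ⟨e, her, heZ⟩ := hrun (l - r)
    have hne : e ≠ r := by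
      rintro rfl
      rw [Nat.sub_add_cancel hl] at heZ
      exact hvZ heZ
    refine Finset.mem_biUnion.2 ⟨r - e, Finset.mem_Icc.2 (by omega), Finset.mem_image.2
      ⟨(l - r + e) % N, ?_, ?_⟩⟩
    · have := h.two_le
      exact Finset.mem_filter.2 ⟨Finset.mem_range.2 (Nat.mod_lt _ (by omega)),
        by rwa [h.apply_mod]⟩
    · rw [h.apply_mod_add]
      congr 1
      omega
  refine (Finset.card_le_card hsub).trans (Finset.card_biUnion_le.trans ?_)
  refine (Finset.sum_le_card_nsmul _ _ I.card fun m _ => Finset.card_image_le).trans ?_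
  simp

variable [Fintype V]

open scoped Classical in
/-- In a tough graph, a connected piece `H` off a longest cycle which is closed under taking
neighbours off the cycle has many neighbours on the cycle. -/
theorem two_mul_le_card_of_isTough (h : G.IsLongestCycle c N) {t : ℝ} (ht : 0 ≤ t)
    (htough : G.IsTough t) {H : Set V} (hne : H.Nonempty) (hoff : ∀ i, c i ∉ H)
    (hconn : ∀ u ∈ H, ∀ v ∈ H, ∃ s, G.HasPathOn s u v ∧ ∀ i, c i ∉ s)
    (hclosed : ∀ u ∈ H, ∀ v, G.Adj u v → v ∈ H ∨ ∃ i, c i = v) :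
    2 * t ≤ ((Finset.range N).filter fun i => ∃ u ∈ H, G.Adj u (c i)).card := by
  set J := (Finset.range N).filter fun i => ∃ u ∈ H, G.Adj u (c i)
  have hmem : ∀ i, c i ∈ J.image c ↔ ∃ u ∈ H, G.Adj u (c i) := by
    intro i
    constructor
    · intro hi
      obtain ⟨l, hl, hli⟩ := Finset.mem_image.1 hi
      rw [← hli]
      exact (Finset.mem_filter.1 hl).2
    · intro hi
      obtain ⟨l, hl, hli⟩ := h.exists_lt i
      exact Finset.mem_image.2 ⟨l, Finset.mem_filter.2 ⟨Finset.mem_range.2 hl, hli ▸ hi⟩, hli⟩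
  have hHS : ∀ u ∈ H, u ∉ J.image c := by
    intro u hu hm
    obtain ⟨l, -, rfl⟩ := Finset.mem_image.1 hm
    exact hoff l hu
  have hcard : (J.image c).card = J.card :=
    Finset.card_image_of_injOn ((h.injOn_range_add 0).mono (Finset.filter_subset _ _))
  -- The cut is the set of neighbours of `H` on the cycle, which separates `H` from the rest. The
  -- rest is nonempty because `c 0` and `c 1` cannot both be neighbours of `H`.
  have key := htough.mul_card_le ht (ι := Bool) (by simp) (J.image c) (fun v => decide (v ∈ H)) ?_ ?_
  · rw [hcard, Fintype.card_bool] at key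
    push_cast at key
    linarith
  · have aux : ∀ a b, b ∉ J.image c → G.Adj a b → a ∈ H → b ∈ H := by
      intro a b hb hab ha
      rcases hclosed a ha b hab with hb' | ⟨i, rfl⟩
      · exact hb'
      · exact absurd ((hmem i).2 ⟨a, ha, hab⟩) hb
    intro a b ha hb hab
    exact decide_eq_decide.2 ⟨aux a b hb hab, aux b a ha hab.symm⟩
  · rintro (_ | _)
    · by_cases h0 : c 0 ∈ J.image c
      · obtain ⟨u, hu, hu0⟩ := (hmem 0).1 h0
        refine ⟨c 1, fun h1 => ?_, by simpa using hoff 1⟩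
        obtain ⟨v, hv, hv1⟩ := (hmem 1).1 h1
        obtain ⟨s, hs, hd⟩ := hconn u hu v hv
        exact h.not_adj_succ hs hd hu0 hv1
      · exact ⟨c 0, h0, by simpa using hoff 0⟩
    · obtain ⟨u, hu⟩ := hne
      exact ⟨u, hHS u hu, by simpa using hu⟩

/-- In a sufficiently tough `(P₂ ∪ kP₁)`-free graph, the vertices off a longest cycle are
independent. -/
theorem not_adj_of_off (h : G.IsLongestCycle c N) {t : ℝ} {k : ℕ} (ht : 0 ≤ t)
    (htk : (k : ℝ) ≤ 2 * t) (htough : G.IsTough t)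
    (hfree : G.IsInducedFree (edgeUnionIsolated k)) {x y : V} (hx : ∀ i, c i ≠ x)
    (hy : ∀ i, c i ≠ y) : ¬ G.Adj x y := by
  classical
  intro hxy
  -- `H` is the component of `x` in the graph off the cycle.
  let H : Set V := {w | ∃ p : G.Walk x w, ∀ z ∈ p.support, ∀ i, c i ≠ z}
  have hoff : ∀ i, c i ∉ H := fun i ⟨p, hp⟩ => hp _ p.end_mem_support i rfl
  have hconn : ∀ u ∈ H, ∀ v ∈ H, ∃ s, G.HasPathOn s u v ∧ ∀ i, c i ∉ s := by
    rintro u ⟨p, hp⟩ v ⟨q, hq⟩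
    refine ⟨_, ⟨(p.reverse.append q).bypass, Walk.bypass_isPath _, rfl⟩, fun i hi => ?_⟩
    have := Walk.support_bypass_subset_support _ (List.mem_toFinset.1 hi)
    rw [Walk.mem_support_append_iff, Walk.support_reverse, List.mem_reverse] at this
    rcases this with h1 | h1
    · exact hp _ h1 i rfl
    · exact hq _ h1 i rfl
  have hext : ∀ u ∈ H, ∀ v, G.Adj u v → (∀ i, c i ≠ v) → v ∈ H := by
    rintro u ⟨p, hp⟩ v huv hv
    refine ⟨p.concat huv, fun z hz => ?_⟩
    rw [Walk.support_concat, List.mem_append, List.mem_singleton] at hz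
    rcases hz with hz | rfl
    · exact hp z hz
    · exact hv
  have hxH : x ∈ H := ⟨.nil, by simpa using hx⟩
  have hyH : y ∈ H := hext x hxH y hxy hy
  have hcard := h.two_mul_le_card_of_isTough ht htough ⟨x, hxH⟩ hoff hconn (by
    intro u hu v huv
    by_cases hv : ∃ i, c i = v
    · exact .inr hv
    · push Not at hv
      exact .inl (hext u hu v huv hv))
  set J := (Finset.range N).filter fun i => ∃ u ∈ H, G.Adj u (c i)
  have hJ : ∀ i ∈ J, i < N ∧ ∃ u ∈ H, G.Adj u (c i) := by
    intro i hi
    simpa [J] using hi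
  have hJcard : (J.image fun i => c (i + 1)).card = J.card :=
    Finset.card_image_of_injOn ((h.injOn_range_add 1).mono (Finset.filter_subset _ _))
  have hnot : ∀ a ∈ J.image fun i => c (i + 1), ∀ u ∈ H, a ≠ u ∧ ¬ G.Adj u a := by
    intro a ha u hu
    obtain ⟨i, hi, rfl⟩ := Finset.mem_image.1 ha
    refine ⟨fun he => hoff (i + 1) (he ▸ hu), ?_⟩
    obtain ⟨-, v, hv, hvi⟩ := hJ i hi
    obtain ⟨s, hs, hd⟩ := hconn v hv u hu
    exact h.not_adj_succ hs hd hvi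
  have hlt := hfree.card_lt hxy (J.image fun i => c (i + 1)) ?_ (fun a ha => hnot a ha x hxH)
    (fun a ha => hnot a ha y hyH)
  · rw [hJcard] at hlt
    have : (J.card : ℝ) < k := by exact_mod_cast hlt
    linarith
  · have aux : ∀ i ∈ J, ∀ j ∈ J, i < j → ¬ G.Adj (c (i + 1)) (c (j + 1)) := by
      intro i hi j hj hij
      obtain ⟨hiN, u, hu, hui⟩ := hJ i hi
      obtain ⟨hjN, v, hv, hvj⟩ := hJ j hj
      obtain ⟨s, hs, hd⟩ := hconn u hu v hv
      exact h.not_adj_succ_succ hs hd hij (by omega) hui hvj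
    intro a ha b hb
    obtain ⟨i, hi, rfl⟩ := Finset.mem_image.1 ha
    obtain ⟨j, hj, rfl⟩ := Finset.mem_image.1 hb
    rcases lt_trichotomy i j with hij | rfl | hij
    · exact aux i hi j hj hij
    · exact G.loopless.irrefl _
    · exact fun hadj => aux j hj i hi hij hadj.symm

open scoped Classical in
theorem two_mul_le_card_nbrs (h : G.IsLongestCycle c N) {t : ℝ} (ht : 0 ≤ t)
    (htough : G.IsTough t) {x : V} (hx : ∀ i, c i ≠ x)
    (hoff : ∀ y, (∀ i, c i ≠ y) → ¬ G.Adj x y) :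
    2 * t ≤ ((Finset.range N).filter fun i => G.Adj x (c i)).card := by
  have := h.two_mul_le_card_of_isTough ht htough (H := {x}) ⟨x, rfl⟩ (fun i => hx i) ?_ ?_
  · simpa using this
  · rintro u rfl v rfl
    exact ⟨_, .singleton _, by simpa using hx⟩
  · rintro u rfl v huv
    by_contra! hv
    exact hoff v hv.2 huv

end IsLongestCycle

end LongestCycle

end SimpleGraph

namespace SimpleGraph

/-! ### The set `A` of `x` and the successors of its neighbours. -/

section SuccessorSet

variable {V : Type*} {G : SimpleGraph V} {c : ℕ → V} {N : ℕ} {x : V} {A : Finset V}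

/-- `A` consists of the vertex `x` off the cycle `c` and of the successors on `c` of its
neighbours. -/
def IsSuccSet (G : SimpleGraph V) (c : ℕ → V) (x : V) (A : Finset V) : Prop :=
  ∀ a, a ∈ A ↔ a = x ∨ ∃ i, G.Adj x (c i) ∧ c (i + 1) = a

/-- `u` has a neighbour in `A`. -/
def HasNbrIn (G : SimpleGraph V) (A : Finset V) (u : V) : Prop := ∃ a ∈ A, G.Adj u a

theorem IsSuccSet.self_mem (hA : IsSuccSet G c x A) : x ∈ A := (hA x).2 (.inl rfl)

theorem IsSuccSet.succ_mem (hA : IsSuccSet G c x A) {i : ℕ} (hi : G.Adj x (c i)) :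
    c (i + 1) ∈ A := (hA _).2 (.inr ⟨i, hi, rfl⟩)

variable [DecidableEq V]

namespace IsLongestCycle

theorem not_adj_succ_of_adj (h : G.IsLongestCycle c N) (hx : ∀ i, c i ≠ x) {i : ℕ}
    (hi : G.Adj x (c i)) : ¬ G.Adj x (c (i + 1)) :=
  h.not_adj_succ (.singleton x) (fun i => by simpa using hx i) hi

/-- Each vertex of `A` on the cycle has an index in any prescribed window of length `N`. -/
theorem exists_index_of_mem (h : G.IsLongestCycle c N) (hA : IsSuccSet G c x A) {a : V}
    (ha : a ∈ A) (hax : a ≠ x) (j : ℕ) :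
    ∃ p, j ≤ p ∧ p < j + N ∧ G.Adj x (c p) ∧ c (p + 1) = a := by
  obtain rfl | ⟨i, hi, rfl⟩ := (hA a).1 ha
  · exact absurd rfl hax
  · obtain ⟨p, hp, hpN, he⟩ := h.exists_index i j
    exact ⟨p, hp, hpN, he ▸ hi, h.apply_succ_eq he⟩

theorem not_adj_of_mem (h : G.IsLongestCycle c N) (hx : ∀ i, c i ≠ x) (hA : IsSuccSet G c x A) :
    ∀ a ∈ A, ∀ b ∈ A, ¬ G.Adj a b := by
  intro a ha b hb
  by_cases hax : a = x
  · subst hax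
    by_cases hba : b = a
    · subst hba
      exact G.loopless.irrefl _
    · obtain ⟨p, -, -, hp, rfl⟩ := h.exists_index_of_mem hA hb hba 0
      exact h.not_adj_succ_of_adj hx hp
  · obtain ⟨p, -, -, hp, rfl⟩ := h.exists_index_of_mem hA ha hax 0
    by_cases hbx : b = x
    · subst hbx
      exact fun hadj => h.not_adj_succ_of_adj hx hp hadj.symm
    · obtain ⟨q, hq, hqN, hxq, rfl⟩ := h.exists_index_of_mem hA hb hbx p
      obtain rfl | hlt := hq.eq_or_lt
      · exact G.loopless.irrefl _
      · exact h.not_adj_succ_succ (.singleton x) (fun i => by simpa using hx i) hlt hqN hp hxq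

section

variable (h : G.IsLongestCycle c N) (hx : ∀ i, c i ≠ x) (hA : IsSuccSet G c x A)
include h hx hA

theorem notMem_of_hasNbrIn {u : V} (hu : G.HasNbrIn A u) : u ∉ A := by
  obtain ⟨a, ha, hua⟩ := hu
  exact fun huA => h.not_adj_of_mem hx hA u huA a ha hua

/-- In a run of consecutive vertices with neighbours in `A`, only the last one can therefore be
adjacent to `x`. -/
theorem not_adj_of_hasNbrIn_succ {i : ℕ} (hi : G.HasNbrIn A (c (i + 1))) : ¬ G.Adj x (c i) :=
  fun hxi => h.notMem_of_hasNbrIn hx hA hi (hA.succ_mem hxi)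

variable (htwo : ∀ u, G.HasNbrIn A u → ∀ a, ∃ b ∈ A, b ≠ a ∧ G.Adj u b)
include htwo

/-- Two neighbours of `y` in `A` would both be successors, since `y` is not adjacent to `x`; this
contradicts `not_adj_two_succ`. -/
theorem not_hasNbrIn_of_off (hoff : ∀ y, (∀ i, c i ≠ y) → ¬ G.Adj x y) {y : V}
    (hy : ∀ i, c i ≠ y) : ¬ G.HasNbrIn A y := by
  intro hyA
  have hyx : ∀ b, G.Adj y b → b ≠ x := by
    rintro b hb rfl
    exact hoff y hy hb.symm
  have hxy : x ≠ y := fun he => h.notMem_of_hasNbrIn hx hA hyA (he ▸ hA.self_mem)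
  obtain ⟨b, hb, -, hyb⟩ := htwo y hyA x
  obtain ⟨a, ha, hab, hya⟩ := htwo y hyA b
  obtain ⟨p, -, -, hp, rfl⟩ := h.exists_index_of_mem hA hb (hyx b hyb) 0
  obtain ⟨q, hq, hqN, hxq, rfl⟩ := h.exists_index_of_mem hA ha (hyx a hya) p
  obtain rfl | hlt := hq.eq_or_lt
  · exact hab rfl
  · exact h.not_adj_two_succ hx hy hxy hlt hqN hp hxq hyb hya

/-- Consecutive vertices of the cycle with neighbours in `A` have no common neighbour in `A`. -/
theorem not_adj_of_adj_succ {j : ℕ} (h0 : G.HasNbrIn A (c j)) (h1 : G.HasNbrIn A (c (j + 1)))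
    {a : V} (ha : a ∈ A) (hja : G.Adj (c j) a) : ¬ G.Adj (c (j + 1)) a := by
  intro hja'
  have hxj := h.not_adj_of_hasNbrIn_succ hx hA h1
  have hax : a ≠ x := by
    rintro rfl
    exact hxj hja.symm
  obtain ⟨i, -, -, hi, rfl⟩ := h.exists_index_of_mem hA ha hax 0
  obtain ⟨l, hl, hlN, hlj⟩ := h.exists_index j (i + 1)
  have hlj' := h.apply_succ_eq hlj
  have hl1 : l ≠ i + 1 := by
    rintro rfl
    exact h.notMem_of_hasNbrIn hx hA h0 (hlj ▸ ha)
  have hl2 : l ≠ i + N := by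
    rintro rfl
    rw [h.periodic] at hlj
    exact hxj (hlj ▸ hi)
  rw [← hlj] at hja hxj
  rw [← hlj'] at hja'
  -- The common neighbour `c (i+1)` can be inserted between `c l` and `c (l+1)`. Its successor `c
  -- (i+2)` has a second neighbour in `A`, through which the cycle can be closed up using `x`.
  have hi2 : G.HasNbrIn A (c (i + 2)) := ⟨_, ha, (h.adj (i + 1)).symm⟩
  obtain ⟨b, hb, hba, hib⟩ := htwo _ hi2 (c (i + 1))
  by_cases hbx : b = x
  · subst hbx
    exact h.not_adj_of_insertable hx (by omega) (by omega) hi hja.symm hja'.symm hib.symm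
  · obtain ⟨p, hp, hpN, hxp, rfl⟩ := h.exists_index_of_mem hA hb hbx i
    have hp1 : p ≠ i := fun he => hba (he ▸ rfl)
    have hp2 : p ≠ i + 1 := fun he => h.not_adj_succ_of_adj hx hi (he ▸ hxp)
    exact h.not_adj_succ_of_insertable hx (by omega) (by omega) hi hja.symm hja'.symm (l := p)
      (by omega) hpN (fun he => hxj (he ▸ hxp)) hxp hib

/-- Among three consecutive vertices with neighbours in `A`, the first and the last one have no
common neighbour in `A`. -/
theorem not_adj_of_adj_add_two {j : ℕ} (h0 : G.HasNbrIn A (c j)) (h1 : G.HasNbrIn A (c (j + 1)))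
    (h2 : G.HasNbrIn A (c (j + 2))) {a : V} (ha : a ∈ A) (hja : G.Adj (c j) a) :
    ¬ G.Adj (c (j + 2)) a := by
  intro hja'
  have hx0 := h.not_adj_of_hasNbrIn_succ hx hA h1
  have hx1 := h.not_adj_of_hasNbrIn_succ hx hA h2
  obtain ⟨b, hb, hjb⟩ := id h1
  have hax : a ≠ x := by
    rintro rfl
    exact hx0 hja.symm
  have hbx : b ≠ x := by
    rintro rfl
    exact hx1 hjb.symm
  obtain ⟨p, hp, hpN, hxp, rfl⟩ := h.exists_index_of_mem hA ha hax j
  obtain ⟨q, hq, hqN, hxq, rfl⟩ := h.exists_index_of_mem hA hb hbx j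
  have hp0 : p ≠ j := fun he => hx0 (he ▸ hxp)
  have hp1 : p ≠ j + 1 := fun he => hx1 (he ▸ hxp)
  have hq0 : q ≠ j := fun he => hx0 (he ▸ hxq)
  have hq1 : q ≠ j + 1 := fun he => hx1 (he ▸ hxq)
  -- With `b` a neighbour of the middle vertex, either order of `a` and `b` gives a crossing with
  -- one of the two outer vertices.
  rcases lt_trichotomy p q with hpq | rfl | hpq
  · exact h.not_crossing hx (by omega) hpq hqN hxp hxq hja hjb
  · exact h.not_adj_of_adj_succ hx hA htwo h0 h1 ha hja hjb
  · exact h.not_crossing hx (j := j + 1) (by omega) hpq (by omega) hxq hxp hjb hja'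

/-- Among four consecutive vertices with neighbours in `A`, the first and the last one have no
common neighbour in `A`. -/
theorem not_adj_of_adj_add_three {j : ℕ} (h0 : G.HasNbrIn A (c j)) (h1 : G.HasNbrIn A (c (j + 1)))
    (h2 : G.HasNbrIn A (c (j + 2))) (h3 : G.HasNbrIn A (c (j + 3))) {a : V} (ha : a ∈ A)
    (hja : G.Adj (c j) a) : ¬ G.Adj (c (j + 3)) a := by
  intro hja'
  have hx0 := h.not_adj_of_hasNbrIn_succ hx hA h1
  have hx1 := h.not_adj_of_hasNbrIn_succ hx hA h2
  have hx2 := h.not_adj_of_hasNbrIn_succ hx hA h3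
  obtain ⟨b, hb, hjb⟩ := id h1
  obtain ⟨e, he, hje⟩ := id h2
  have hax : a ≠ x := by
    rintro rfl
    exact hx0 hja.symm
  have hbx : b ≠ x := by
    rintro rfl
    exact hx1 hjb.symm
  have hex : e ≠ x := by
    rintro rfl
    exact hx2 hje.symm
  have window : ∀ {y}, y ∈ A → y ≠ x →
      ∃ p, j + 3 ≤ p ∧ p < j + N ∧ G.Adj x (c p) ∧ c (p + 1) = y := by
    intro y hy hyx
    obtain ⟨p, hp, hpN, hxp, hpy⟩ := h.exists_index_of_mem hA hy hyx j
    have hp0 : p ≠ j := fun he => hx0 (he ▸ hxp)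
    have hp1 : p ≠ j + 1 := fun he => hx1 (he ▸ hxp)
    have hp2 : p ≠ j + 2 := fun he => hx2 (he ▸ hxp)
    exact ⟨p, by omega, hpN, hxp, hpy⟩
  obtain ⟨p, hp, hpN, hxp, rfl⟩ := window ha hax
  obtain ⟨q, hq, hqN, hxq, rfl⟩ := window hb hbx
  obtain ⟨r, hr, hrN, hxr, rfl⟩ := window he hex
  -- Without crossings, the positions weakly decrease along the run; returning to `a` makes them all
  -- equal.
  have hqp : q ≤ p := by
    by_contra! hlt
    exact h.not_crossing hx (by omega) hlt hqN hxp hxq hja hjb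
  have hrq : r ≤ q := by
    by_contra! hlt
    exact h.not_crossing hx (j := j + 1) (by omega) hlt (by omega) hxq hxr hjb hje
  have hpr : p ≤ r := by
    by_contra! hlt
    exact h.not_crossing hx (j := j + 2) (by omega) hlt (by omega) hxr hxp hje hja'
  obtain rfl : p = q := by omega
  exact h.not_adj_of_adj_succ hx hA htwo h0 h1 ha hja hjb

end

/-! ### Runs of vertices with neighbours in `A`. -/

section Counting

variable (h : G.IsLongestCycle c N) (hx : ∀ i, c i ≠ x) (hA : IsSuccSet G c x A)
  (htwo : ∀ u, G.HasNbrIn A u → ∀ a, ∃ b ∈ A, b ≠ a ∧ G.Adj u b) {m : ℕ}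
include h hx hA htwo

open scoped Classical in
theorem two_mul_le_card (hm : ∀ u, G.HasNbrIn A u → m ≤ (A.filter (G.Adj u)).card) {j : ℕ}
    (h0 : G.HasNbrIn A (c j)) (h1 : G.HasNbrIn A (c (j + 1))) : 2 * m ≤ A.card := by
  have hd : Disjoint (A.filter (G.Adj (c j))) (A.filter (G.Adj (c (j + 1)))) :=
    Finset.disjoint_filter.2 fun a ha => h.not_adj_of_adj_succ hx hA htwo h0 h1 ha
  have hsub := Finset.card_le_card (Finset.union_subset (Finset.filter_subset (G.Adj (c j)) A)
    (Finset.filter_subset (G.Adj (c (j + 1))) A))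
  rw [Finset.card_union_of_disjoint hd] at hsub
  have := hm _ h0
  have := hm _ h1
  omega

open scoped Classical in
theorem three_mul_le_card (hm : ∀ u, G.HasNbrIn A u → m ≤ (A.filter (G.Adj u)).card) {j : ℕ}
    (h0 : G.HasNbrIn A (c j)) (h1 : G.HasNbrIn A (c (j + 1))) (h2 : G.HasNbrIn A (c (j + 2))) :
    3 * m ≤ A.card := by
  have hd1 : Disjoint (A.filter (G.Adj (c j))) (A.filter (G.Adj (c (j + 1)))) :=
    Finset.disjoint_filter.2 fun a ha => h.not_adj_of_adj_succ hx hA htwo h0 h1 ha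
  have hd2 : Disjoint (A.filter (G.Adj (c j)) ∪ A.filter (G.Adj (c (j + 1))))
      (A.filter (G.Adj (c (j + 2)))) := Finset.disjoint_union_left.2
    ⟨Finset.disjoint_filter.2 fun a ha => h.not_adj_of_adj_add_two hx hA htwo h0 h1 h2 ha,
      Finset.disjoint_filter.2 fun a ha => h.not_adj_of_adj_succ hx hA htwo h1 h2 ha⟩
  have hsub := Finset.card_le_card (Finset.union_subset (Finset.union_subset
    (Finset.filter_subset (G.Adj (c j)) A) (Finset.filter_subset (G.Adj (c (j + 1))) A))
    (Finset.filter_subset (G.Adj (c (j + 2))) A))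
  rw [Finset.card_union_of_disjoint hd2, Finset.card_union_of_disjoint hd1] at hsub
  have := hm _ h0
  have := hm _ h1
  have := hm _ h2
  omega

open scoped Classical in
theorem four_mul_le_card (hm : ∀ u, G.HasNbrIn A u → m ≤ (A.filter (G.Adj u)).card) {j : ℕ}
    (h0 : G.HasNbrIn A (c j)) (h1 : G.HasNbrIn A (c (j + 1))) (h2 : G.HasNbrIn A (c (j + 2)))
    (h3 : G.HasNbrIn A (c (j + 3))) : 4 * m ≤ A.card := by
  have hd1 : Disjoint (A.filter (G.Adj (c j))) (A.filter (G.Adj (c (j + 1)))) :=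
    Finset.disjoint_filter.2 fun a ha => h.not_adj_of_adj_succ hx hA htwo h0 h1 ha
  have hd2 : Disjoint (A.filter (G.Adj (c j)) ∪ A.filter (G.Adj (c (j + 1))))
      (A.filter (G.Adj (c (j + 2)))) := Finset.disjoint_union_left.2
    ⟨Finset.disjoint_filter.2 fun a ha => h.not_adj_of_adj_add_two hx hA htwo h0 h1 h2 ha,
      Finset.disjoint_filter.2 fun a ha => h.not_adj_of_adj_succ hx hA htwo h1 h2 ha⟩
  have hd3 : Disjoint (A.filter (G.Adj (c j)) ∪ A.filter (G.Adj (c (j + 1))) ∪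
      A.filter (G.Adj (c (j + 2)))) (A.filter (G.Adj (c (j + 3)))) := Finset.disjoint_union_left.2
    ⟨Finset.disjoint_union_left.2
      ⟨Finset.disjoint_filter.2 fun a ha => h.not_adj_of_adj_add_three hx hA htwo h0 h1 h2 h3 ha,
        Finset.disjoint_filter.2 fun a ha => h.not_adj_of_adj_add_two hx hA htwo h1 h2 h3 ha⟩,
      Finset.disjoint_filter.2 fun a ha => h.not_adj_of_adj_succ hx hA htwo h2 h3 ha⟩
  have hsub := Finset.card_le_card (Finset.union_subset (Finset.union_subset (Finset.union_subset
    (Finset.filter_subset (G.Adj (c j)) A) (Finset.filter_subset (G.Adj (c (j + 1))) A))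
    (Finset.filter_subset (G.Adj (c (j + 2))) A)) (Finset.filter_subset (G.Adj (c (j + 3))) A))
  rw [Finset.card_union_of_disjoint hd3, Finset.card_union_of_disjoint hd2,
    Finset.card_union_of_disjoint hd1] at hsub
  have := hm _ h0
  have := hm _ h1
  have := hm _ h2
  have := hm _ h3
  omega

end Counting

end IsLongestCycle

end SuccessorSet

end SimpleGraph

namespace SimpleGraph
namespace IsLongestCycle
-- The spanning Petersen graph.
section Petersen

variable {V : Type*} [DecidableEq V] {G : SimpleGraph V} {c : ℕ → V} {x : V}

/-- A spanning Petersen graph: a longest cycle of length nine and a vertex `x` off it. There are no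
edges between the two pairs `c 2, c 3` and `c 5, c 6`, since adding an edge to the Petersen graph
makes it hamiltonian. -/
theorem not_adj_of_petersen (h : G.IsLongestCycle c 9) (hx : ∀ i, c i ≠ x) (h0 : G.Adj x (c 0))
    (h3 : G.Adj x (c 3)) (h6 : G.Adj x (c 6)) (h27 : G.Adj (c 2) (c 7)) (h51 : G.Adj (c 5) (c 1))
    (h84 : G.Adj (c 8) (c 4)) :
    (¬ G.Adj (c 2) (c 5) ∧ ¬ G.Adj (c 2) (c 6)) ∧ ¬ G.Adj (c 3) (c 5) ∧ ¬ G.Adj (c 3) (c 6) := by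
  have hdx : ∀ i j, Disjoint {x} ((Finset.Icc i j).image c) :=
    fun i j => (disjoint_arc_singleton hx i j).symm
  have hd : ∀ {i j i' j'}, j ≤ 8 → j' ≤ 8 → j < i' ∨ j' < i →
      Disjoint ((Finset.Icc i j).image c) ((Finset.Icc i' j').image c) := by
    rintro i j i' j' hj hj' (hlt | hlt)
    · exact h.disjoint_arc hlt (by omega)
    · exact (h.disjoint_arc hlt (by omega)).symm
  have arc : ∀ i j, i ≤ j → j ≤ 8 → G.HasPathOn ((Finset.Icc i j).image c) (c i) (c j) :=
    fun i j hij hj => h.hasPathOn_arc hij (by omega)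
  have hcard : ∀ i j, j ≤ 8 → ((Finset.Icc i j).image c).card = j + 1 - i :=
    fun i j hj => h.card_arc (by omega)
  -- Each of the four edges would close a cycle through all ten vertices.
  refine ⟨⟨fun he => ?_, fun he => ?_⟩, fun he => ?_, fun he => ?_⟩
  · have d1 := hdx 0 2
    have d2 := Finset.disjoint_union_left.2 ⟨hdx 5 8, hd (i := 0) (j := 2) (i' := 5) (j' := 8)
      (by omega) (by omega) (by omega)⟩
    have d3 := Finset.disjoint_union_left.2 ⟨Finset.disjoint_union_left.2 ⟨hdx 3 4,
      hd (i := 0) (j := 2) (i' := 3) (j' := 4) (by omega) (by omega) (by omega)⟩,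
      hd (i := 5) (j := 8) (i' := 3) (j' := 4) (by omega) (by omega) (by omega)⟩
    have hP := (((HasPathOn.singleton x).append (arc 0 2 (by omega) (by omega)) d1 h0).append
      (arc 5 8 (by omega) (by omega)) d2 he).append (arc 3 4 (by omega) (by omega)).symm d3 h84
    have := h.card_le _ _ _ hP h3.symm
    rw [Finset.card_union_of_disjoint d3, Finset.card_union_of_disjoint d2,
      Finset.card_union_of_disjoint d1, hcard _ _ (by omega), hcard _ _ (by omega),
      hcard _ _ (by omega), Finset.card_singleton] at this
    omega
  · have d1 := hdx 0 1
    have d2 := Finset.disjoint_union_left.2 ⟨hdx 4 5, hd (i := 0) (j := 1) (i' := 4) (j' := 5)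
      (by omega) (by omega) (by omega)⟩
    have d3 := Finset.disjoint_union_left.2 ⟨Finset.disjoint_union_left.2 ⟨hdx 6 8,
      hd (i := 0) (j := 1) (i' := 6) (j' := 8) (by omega) (by omega) (by omega)⟩,
      hd (i := 4) (j := 5) (i' := 6) (j' := 8) (by omega) (by omega) (by omega)⟩
    have d4 := Finset.disjoint_union_left.2 ⟨Finset.disjoint_union_left.2
      ⟨Finset.disjoint_union_left.2 ⟨hdx 2 3,
      hd (i := 0) (j := 1) (i' := 2) (j' := 3) (by omega) (by omega) (by omega)⟩,
      hd (i := 4) (j := 5) (i' := 2) (j' := 3) (by omega) (by omega) (by omega)⟩,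
      hd (i := 6) (j := 8) (i' := 2) (j' := 3) (by omega) (by omega) (by omega)⟩
    have hP := ((((HasPathOn.singleton x).append (arc 0 1 (by omega) (by omega)) d1 h0).append
      (arc 4 5 (by omega) (by omega)).symm d2 h51.symm).append
      (arc 6 8 (by omega) (by omega)).symm d3 h84.symm).append
      (arc 2 3 (by omega) (by omega)) d4 he.symm
    have := h.card_le _ _ _ hP h3.symm
    rw [Finset.card_union_of_disjoint d4, Finset.card_union_of_disjoint d3,
      Finset.card_union_of_disjoint d2, Finset.card_union_of_disjoint d1, hcard _ _ (by omega),
      hcard _ _ (by omega), hcard _ _ (by omega), hcard _ _ (by omega),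
      Finset.card_singleton] at this
    omega
  · have d1 := hdx 0 3
    have d2 := Finset.disjoint_union_left.2 ⟨hdx 4 5, hd (i := 0) (j := 3) (i' := 4) (j' := 5)
      (by omega) (by omega) (by omega)⟩
    have d3 := Finset.disjoint_union_left.2 ⟨Finset.disjoint_union_left.2 ⟨hdx 6 8,
      hd (i := 0) (j := 3) (i' := 6) (j' := 8) (by omega) (by omega) (by omega)⟩,
      hd (i := 4) (j := 5) (i' := 6) (j' := 8) (by omega) (by omega) (by omega)⟩
    have hP := (((HasPathOn.singleton x).append (arc 0 3 (by omega) (by omega)) d1 h0).append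
      (arc 4 5 (by omega) (by omega)).symm d2 he).append
      (arc 6 8 (by omega) (by omega)).symm d3 h84.symm
    have := h.card_le _ _ _ hP h6.symm
    rw [Finset.card_union_of_disjoint d3, Finset.card_union_of_disjoint d2,
      Finset.card_union_of_disjoint d1, hcard _ _ (by omega), hcard _ _ (by omega),
      hcard _ _ (by omega), Finset.card_singleton] at this
    omega
  · have d1 := hdx 0 2
    have d2 := Finset.disjoint_union_left.2 ⟨hdx 7 8, hd (i := 0) (j := 2) (i' := 7) (j' := 8)
      (by omega) (by omega) (by omega)⟩
    have d3 := Finset.disjoint_union_left.2 ⟨Finset.disjoint_union_left.2 ⟨hdx 4 6,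
      hd (i := 0) (j := 2) (i' := 4) (j' := 6) (by omega) (by omega) (by omega)⟩,
      hd (i := 7) (j := 8) (i' := 4) (j' := 6) (by omega) (by omega) (by omega)⟩
    have d4 := Finset.disjoint_union_left.2 ⟨Finset.disjoint_union_left.2
      ⟨Finset.disjoint_union_left.2 ⟨hdx 3 3,
      hd (i := 0) (j := 2) (i' := 3) (j' := 3) (by omega) (by omega) (by omega)⟩,
      hd (i := 7) (j := 8) (i' := 3) (j' := 3) (by omega) (by omega) (by omega)⟩,
      hd (i := 4) (j := 6) (i' := 3) (j' := 3) (by omega) (by omega) (by omega)⟩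
    have hP := ((((HasPathOn.singleton x).append (arc 0 2 (by omega) (by omega)) d1 h0).append
      (arc 7 8 (by omega) (by omega)) d2 h27).append
      (arc 4 6 (by omega) (by omega)) d3 h84).append
      (arc 3 3 (by omega) (by omega)) d4 he.symm
    have := h.card_le _ _ _ hP h3.symm
    rw [Finset.card_union_of_disjoint d4, Finset.card_union_of_disjoint d3,
      Finset.card_union_of_disjoint d2, Finset.card_union_of_disjoint d1, hcard _ _ (by omega),
      hcard _ _ (by omega), hcard _ _ (by omega), hcard _ _ (by omega),
      Finset.card_singleton] at this
    omega

/-- The Petersen graph is not `3/2`-tough. -/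
theorem false_of_petersen [Fintype V] (h : G.IsLongestCycle c 9) (hx : ∀ i, c i ≠ x)
    (hcover : ∀ v, v = x ∨ ∃ i, c i = v) (h0 : G.Adj x (c 0))
    (h3 : G.Adj x (c 3)) (h6 : G.Adj x (c 6)) (h27 : G.Adj (c 2) (c 7)) (h51 : G.Adj (c 5) (c 1))
    (h84 : G.Adj (c 8) (c 4)) (htough : G.IsTough (3 / 2)) : False := by
  have per : ∀ i, c (i + 9) = c i := h.periodic
  have n1 := h.not_adj_of_petersen hx h0 h3 h6 h27 h51 h84
  have p0 : G.Adj x (c (0 + 9)) := by rwa [per]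
  have p3 : G.Adj x (c (3 + 9)) := by rwa [per]
  have p27 : G.Adj (c (2 + 9)) (c 7) := by rwa [per]
  have p51 : G.Adj (c 5) (c (1 + 9)) := by rwa [per]
  have p51' : G.Adj (c (5 + 9)) (c (1 + 9)) := by rwa [per, per]
  have p84 : G.Adj (c 8) (c (4 + 9)) := by rwa [per]
  -- Rotation by three steps preserves the configuration, so the other two pairs of classes follow.
  have n2 := (h.shift 3).not_adj_of_petersen (fun i => hx _) h3 h6 p0 p51 h84 p27
  have n3 := (h.shift 6).not_adj_of_petersen (fun i => hx _) h6 p0 p3 p84 p27 p51'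
  simp only [show 2 + 3 = 5 from rfl, show 5 + 3 = 8 from rfl, show 6 + 3 = 0 + 9 from rfl,
    show 3 + 3 = 6 from rfl, per] at n2
  simp only [show 2 + 6 = 8 from rfl, show 5 + 6 = 2 + 9 from rfl,
    show 6 + 6 = 3 + 9 from rfl, show 3 + 6 = 0 + 9 from rfl, per] at n3
  have hne : ∀ i j, i < j → j < 9 → c i ≠ c j := fun i j hij hj => h.ne i j hij (by omega)
  -- Deleting these four vertices leaves three parts `{c 2, c 3}`, `{c 5, c 6}`, `{c 8, c 0}`, and
  -- $4<\frac32\cdot 3$.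
  set S : Finset V := {x, c 1, c 4, c 7} with hS
  have hcov : ∀ v, v ∉ S → v = c 2 ∨ v = c 3 ∨ v = c 5 ∨ v = c 6 ∨ v = c 8 ∨ v = c 0 := by
    intro v hv
    rcases hcover v with rfl | ⟨i, rfl⟩
    · simp [hS] at hv
    · obtain ⟨l, -, hl, hli⟩ := h.exists_index i 0
      rw [← hli] at hv ⊢
      simp only [hS, Finset.mem_insert, Finset.mem_singleton, not_or] at hv
      interval_cases l <;> simp_all
  let f : V → Fin 3 := fun v => if v = c 2 ∨ v = c 3 then 0 else if v = c 5 ∨ v = c 6 then 1 else 2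
  have f2 : f (c 2) = 0 := by simp [f]
  have f3 : f (c 3) = 0 := by simp [f]
  have f5 : f (c 5) = 1 := by
    simp [f, (hne 2 5 (by omega) (by omega)).symm, (hne 3 5 (by omega) (by omega)).symm]
  have f6 : f (c 6) = 1 := by
    simp [f, (hne 2 6 (by omega) (by omega)).symm, (hne 3 6 (by omega) (by omega)).symm]
  have f8 : f (c 8) = 2 := by
    simp [f, (hne 2 8 (by omega) (by omega)).symm, (hne 3 8 (by omega) (by omega)).symm,
      (hne 5 8 (by omega) (by omega)).symm, (hne 6 8 (by omega) (by omega)).symm]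
  have f0 : f (c 0) = 2 := by
    simp [f, hne 0 2 (by omega) (by omega), hne 0 3 (by omega) (by omega),
      hne 0 5 (by omega) (by omega), hne 0 6 (by omega) (by omega)]
  have hnS : ∀ i, i < 9 → i ≠ 1 → i ≠ 4 → i ≠ 7 → c i ∉ S := by
    intro i hi h1 h4 h7
    simp only [hS, Finset.mem_insert, Finset.mem_singleton, not_or]
    exact ⟨hx i, fun he => h1 (h.eq_of_apply_eq he (by omega) (by omega)),
      fun he => h4 (h.eq_of_apply_eq he (by omega) (by omega)),
      fun he => h7 (h.eq_of_apply_eq he (by omega) (by omega))⟩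
  have key := htough.mul_card_le (by norm_num) (ι := Fin 3) (by simp) S f ?_ ?_
  · have hSc : S.card ≤ 4 := Finset.card_le_four
    have : (S.card : ℝ) ≤ 4 := by exact_mod_cast hSc
    rw [Fintype.card_fin] at key
    norm_num at key
    linarith
  · obtain ⟨⟨n25, n26⟩, n35, n36⟩ := n1
    obtain ⟨⟨n58, n50⟩, n68, n60⟩ := n2
    obtain ⟨⟨n82, n83⟩, n02, n03⟩ := n3
    intro a b ha hb hab
    rcases hcov a ha with rfl | rfl | rfl | rfl | rfl | rfl <;>
    rcases hcov b hb with rfl | rfl | rfl | rfl | rfl | rfl <;>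
    first
    | (simp only [f2, f3, f5, f6, f8, f0]; done)
    | exact absurd hab (by assumption)
    | exact absurd hab.symm (by assumption)
  · intro i
    fin_cases i
    · exact ⟨c 2, hnS 2 (by omega) (by omega) (by omega) (by omega), f2⟩
    · exact ⟨c 5, hnS 5 (by omega) (by omega) (by omega) (by omega), f5⟩
    · exact ⟨c 8, hnS 8 (by omega) (by omega) (by omega) (by omega), f8⟩

end Petersen
end IsLongestCycle
end SimpleGraph

namespace SimpleGraph

/-! ### The extremal case, and the final count. -/

namespace IsLongestCycle

variable {V : Type*} [Fintype V] [DecidableEq V] {G : SimpleGraph V} {c : ℕ → V} {N : ℕ}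
  {x : V} {A : Finset V}

open scoped Classical in
/-- A `3/2`-tough graph in which every vertex with a neighbour in the four-element set `A` has at
least two of them: the cycle has length nine and `G` contains a spanning Petersen graph. -/
theorem false_of_card_eq_four (h : G.IsLongestCycle c N) (hx : ∀ i, c i ≠ x)
    (hA : IsSuccSet G c x A) (hA4 : A.card = 4)
    (htwo : ∀ u, G.HasNbrIn A u → ∀ a, ∃ b ∈ A, b ≠ a ∧ G.Adj u b)
    (hoff : ∀ y, (∀ i, c i ≠ y) → ¬ G.HasNbrIn A y)
    (hm : ∀ u, G.HasNbrIn A u → 2 ≤ (A.filter (G.Adj u)).card)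
    (hJ : ((Finset.range N).filter fun i => G.Adj x (c i)).card = 3)
    (hI : ((Finset.range N).filter fun i => ¬ G.HasNbrIn A (c i)).card + 1 ≤
      (Finset.univ.filter fun v => ¬ G.HasNbrIn A v).card)
    (hR : 3 * (Finset.univ.filter fun v => ¬ G.HasNbrIn A v).card ≤
      2 * (Finset.univ.filter fun v => G.HasNbrIn A v).card)
    (htough : G.IsTough (3 / 2)) : False := by
  have hN := h.two_le
  set J := (Finset.range N).filter fun i => G.Adj x (c i)
  set I := (Finset.range N).filter fun i => ¬ G.HasNbrIn A (c i)
  set Z := Finset.univ.filter fun v => ¬ G.HasNbrIn A v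
  set R := Finset.univ.filter fun v => G.HasNbrIn A v
  have hAZ : A ⊆ Z := by
    intro a ha
    refine Finset.mem_filter.2 ⟨Finset.mem_univ _, ?_⟩
    exact fun hn => h.notMem_of_hasNbrIn hx hA hn ha
  have hZ4 : 4 ≤ Z.card := hA4 ▸ Finset.card_le_card hAZ
  have hmemI : ∀ i, ¬ G.HasNbrIn A (c i) → c (i + 1) ∈ I.image fun i => c (i + 1) := by
    intro i hi
    refine Finset.mem_image.2 ⟨i % N, Finset.mem_filter.2
      ⟨Finset.mem_range.2 (Nat.mod_lt _ (by omega)), by rwa [h.apply_mod]⟩, h.apply_mod_add _ _⟩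
  have hmemJ : ∀ i, G.Adj x (c i) → c i ∈ J.image c := by
    intro i hi
    exact Finset.mem_image.2 ⟨i % N, Finset.mem_filter.2
      ⟨Finset.mem_range.2 (Nat.mod_lt _ (by omega)), by rwa [h.apply_mod]⟩, h.apply_mod i⟩
  -- a vertex with neighbours in `A` follows one without, or is adjacent to `x`
  have hsplit : ∀ i, G.HasNbrIn A (c i) → G.HasNbrIn A (c (i + 1)) → G.Adj x (c (i + 1)) := by
    intro i h0 h1
    by_contra hxi
    have hx0 := h.not_adj_of_hasNbrIn_succ hx hA h1
    have hd : Disjoint (A.filter (G.Adj (c i))) (A.filter (G.Adj (c (i + 1)))) :=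
      Finset.disjoint_filter.2 fun a ha => h.not_adj_of_adj_succ hx hA htwo h0 h1 ha
    -- Two disjoint sets of at least two vertices do not fit into the three vertices of `A` other
    -- than `x`.
    have hsub : A.filter (G.Adj (c i)) ∪ A.filter (G.Adj (c (i + 1))) ⊆ A.erase x := by
      intro a ha
      rw [Finset.mem_union, Finset.mem_filter, Finset.mem_filter] at ha
      rcases ha with ⟨ha, hadj⟩ | ⟨ha, hadj⟩
      · exact Finset.mem_erase.2 ⟨fun he => hx0 (he ▸ hadj).symm, ha⟩
      · exact Finset.mem_erase.2 ⟨fun he => hxi (he ▸ hadj).symm, ha⟩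
    have hc := Finset.card_le_card hsub
    rw [Finset.card_union_of_disjoint hd, Finset.card_erase_of_mem hA.self_mem, hA4] at hc
    have := hm _ h0
    have := hm _ h1
    omega
  have hRsub : R ⊆ (I.image fun i => c (i + 1)) ∪ J.image c := by
    intro v hv
    have hv := (Finset.mem_filter.1 hv).2
    by_cases hvC : ∃ i, c i = v
    · obtain ⟨i, rfl⟩ := hvC
      obtain ⟨l, hl, -, hli⟩ := h.exists_index i 1
      obtain ⟨l, rfl⟩ : ∃ l', l = l' + 1 := ⟨l - 1, by omega⟩
      rw [← hli] at hv ⊢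
      by_cases h0 : G.HasNbrIn A (c l)
      · exact Finset.mem_union_right _ (hmemJ _ (hsplit l h0 hv))
      · exact Finset.mem_union_left _ (hmemI l h0)
    · push Not at hvC
      exact absurd hv (hoff v hvC)
  have hRcard := Finset.card_le_card hRsub
  have hIc : (I.image fun i => c (i + 1)).card ≤ I.card := Finset.card_image_le
  have hJc : (J.image c).card ≤ J.card := Finset.card_image_le
  have hui := Finset.card_union_add_card_inter (I.image fun i => c (i + 1)) (J.image c)
  -- The bounds $|R|\le|I|+3$, $|I|+1\le|Z|$, $3|Z|\le2|R|$ and $|Z|\ge4$ are all tight: $|Z|=4$,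
  -- $|R|=6$, and the union is disjoint.
  have hinter : ((I.image fun i => c (i + 1)) ∩ J.image c) = ∅ := by
    rw [← Finset.card_eq_zero]
    omega
  have hZA : Z = A := (Finset.eq_of_subset_of_card_le hAZ (by omega)).symm
  have hZmem : ∀ v, ¬ G.HasNbrIn A v → v ∈ A := by
    intro v hv
    rw [← hZA]
    exact Finset.mem_filter.2 ⟨Finset.mem_univ _, hv⟩
  have hcover : ∀ v, v = x ∨ ∃ i, c i = v := by
    intro v
    by_cases hvC : ∃ i, c i = v
    · exact .inr hvC
    · have hvC' : ∀ i, c i ≠ v := by simpa using hvC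
      rcases (hA v).1 (hZmem v (hoff v hvC')) with hvx | ⟨i, -, hi⟩
      · exact .inl hvx
      · exact .inr ⟨_, hi⟩
  have hN9 : N = 9 := by
    have h1 : insert x ((Finset.range N).image c) = Finset.univ := by
      refine Finset.eq_univ_of_forall fun v => ?_
      rcases hcover v with rfl | ⟨i, rfl⟩
      · exact Finset.mem_insert_self _ _
      · obtain ⟨l, hl, hli⟩ := h.exists_lt i
        exact Finset.mem_insert_of_mem (Finset.mem_image.2 ⟨l, Finset.mem_range.2 hl, hli⟩)
    have h2 : x ∉ (Finset.range N).image c := by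
      intro hm
      obtain ⟨i, -, hi⟩ := Finset.mem_image.1 hm
      exact hx i hi
    have h3 := congrArg Finset.card h1
    rw [Finset.card_insert_of_notMem h2, Finset.card_image_of_injOn (f := c) (h.injOn_range_add 0),
      Finset.card_range, ← Finset.card_filter_add_card_filter_not (G.HasNbrIn A)] at h3
    change _ = R.card + Z.card at h3
    omega
  subst hN9
  have hmemA : ∀ {i}, G.Adj x (c i) → ¬ G.HasNbrIn A (c (i + 1)) := fun hi hn =>
    h.notMem_of_hasNbrIn hx hA hn (hA.succ_mem hi)
  have hnbr2 : ∀ {i}, G.Adj x (c i) → G.HasNbrIn A (c (i + 2)) := fun {i} hi =>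
    ⟨_, hA.succ_mem hi, (h.adj (i + 1)).symm⟩
  have hnot2 : ∀ {i}, G.Adj x (c i) → ¬ G.Adj x (c (i + 2)) := by
    intro i hi hi2
    exact Finset.notMem_empty _ (hinter ▸
      Finset.mem_inter.2 ⟨hmemI (i + 1) (hmemA hi), hmemJ _ hi2⟩)
  have hnbr3 : ∀ {i}, G.Adj x (c i) → G.HasNbrIn A (c (i + 3)) := by
    intro i hi
    by_contra hn
    rcases (hA _).1 (hZmem _ hn) with he | ⟨l, hl, he⟩
    · exact hx _ he
    · exact hnot2 hi (h.eq_of_apply_succ_eq he ▸ hl)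
  have hstep : ∀ {i}, G.Adj x (c i) → G.Adj x (c (i + 3)) := fun hi =>
    hsplit _ (hnbr2 hi) (hnbr3 hi)
  -- Here `A` is `x, c (i+1), c (i+4), c (i+7)`. The vertex `c (i+2)` needs a second neighbour
  -- there; `x` is excluded by `hnot2`, and `c (i+4)` because it is adjacent to the next vertex `c
  -- (i+3)`.
  have hchord : ∀ {i}, G.Adj x (c i) → G.Adj (c (i + 2)) (c (i + 7)) := by
    intro i hi
    have hi3 := hstep hi
    have hi6 := hstep hi3
    by_contra hno
    have hsub : A.filter (G.Adj (c (i + 2))) ⊆ {c (i + 1)} := by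
      intro a ha
      obtain ⟨ha, hadj⟩ := Finset.mem_filter.1 ha
      rw [Finset.mem_singleton]
      have hax : a ≠ x := by
        rintro rfl
        exact hnot2 hi hadj.symm
      obtain ⟨p, hp, hpN, hxp, rfl⟩ := h.exists_index_of_mem hA ha hax i
      obtain ⟨e, rfl⟩ := Nat.exists_eq_add_of_le hp
      have he : e < 9 := by omega
      interval_cases e
      · rfl
      · exact absurd hxp (h.not_adj_succ_of_adj hx hi)
      · exact absurd hxp (hnot2 hi)
      · exact absurd (h.adj (i + 3)) (h.not_adj_of_adj_succ hx hA htwo (hnbr2 hi) (hnbr3 hi)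
          ha hadj)
      · exact absurd hxp (h.not_adj_succ_of_adj hx hi3)
      · exact absurd hxp (hnot2 hi3)
      · exact absurd hadj hno
      · exact absurd hxp (h.not_adj_succ_of_adj hx hi6)
      · exact absurd hxp (hnot2 hi6)
    have h1 := Finset.card_le_card hsub
    have h2 := hm _ (hnbr2 hi)
    rw [Finset.card_singleton] at h1
    omega
  obtain ⟨i, hi⟩ : J.Nonempty := Finset.card_pos.1 (by omega)
  have hi := (Finset.mem_filter.1 hi).2
  have hi3 := hstep hi
  have hi6 := hstep hi3
  have h51 := hchord hi3
  have h84 := hchord hi6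
  rw [show i + 3 + 7 = i + 1 + 9 by omega, h.periodic] at h51
  rw [show i + 3 + 3 + 7 = i + 4 + 9 by omega, h.periodic] at h84
  refine (h.shift i).false_of_petersen (x := x) (fun j => hx _) ?_ ?_ ?_ ?_ ?_ ?_ ?_ htough
  · intro v
    rcases hcover v with hv | ⟨j, rfl⟩
    · exact .inl hv
    · obtain ⟨l, hl, -, hlj⟩ := h.exists_index j i
      exact .inr ⟨l - i, by rw [Nat.sub_add_cancel hl, hlj]⟩
  · simpa using hi
  · simpa [add_comm] using hi3
  · rw [show 6 + i = i + 3 + 3 by omega]; exact hi6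
  · rw [show 2 + i = i + 2 by omega, show 7 + i = i + 7 by omega]; exact hchord hi
  · rw [show 5 + i = i + 3 + 2 by omega, show 1 + i = i + 1 by omega]; exact h51
  · rw [show 8 + i = i + 3 + 3 + 2 by omega, show 4 + i = i + 4 by omega]; exact h84

/-- A longest cycle of a `(7k - 6)/10`-tough `(P₂ ∪ kP₁)`-free graph is a Hamiltonian cycle. -/
theorem exists_apply_eq (h : G.IsLongestCycle c N) {k : ℕ} (hk : 3 ≤ k)
    (htough : G.IsTough ((7 * (k : ℝ) - 6) / 10))
    (hfree : G.IsInducedFree (edgeUnionIsolated k)) (x : V) : ∃ i, c i = x := by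
  classical
  by_contra! hx
  have hk' : (3 : ℝ) ≤ k := by exact_mod_cast hk
  have ht : 0 ≤ (7 * (k : ℝ) - 6) / 10 := by linarith
  have hoff : ∀ y, (∀ i, c i ≠ y) → ¬ G.Adj x y := fun y hy =>
    h.not_adj_of_off ht (by linarith) htough hfree hx hy
  have hd := h.two_mul_le_card_nbrs ht htough hx hoff
  set J := (Finset.range N).filter fun i => G.Adj x (c i)
  have hd' : 7 * k ≤ 5 * J.card + 6 := by
    have : 7 * (k : ℝ) ≤ 5 * J.card + 6 := by linarith
    exact_mod_cast this
  set A := insert x (J.image fun i => c (i + 1)) with hAdef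
  have hA : IsSuccSet G c x A := by
    intro a
    rw [hAdef, Finset.mem_insert, Finset.mem_image]
    refine or_congr_right ⟨?_, ?_⟩
    · rintro ⟨i, hi, rfl⟩
      exact ⟨i, (Finset.mem_filter.1 hi).2, rfl⟩
    · rintro ⟨i, hi, rfl⟩
      obtain ⟨l, hl, hli⟩ := h.exists_lt i
      exact ⟨l, Finset.mem_filter.2 ⟨Finset.mem_range.2 hl, hli ▸ hi⟩, h.apply_succ_eq hli⟩
  have hAcard : A.card = J.card + 1 := by
    rw [hAdef, Finset.card_insert_of_notMem, Finset.card_image_of_injOn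
      ((h.injOn_range_add 1).mono (Finset.filter_subset _ _))]
    intro hm
    obtain ⟨i, -, hi⟩ := Finset.mem_image.1 hm
    exact hx _ hi
  have hAind := h.not_adj_of_mem hx hA
  have hm : ∀ u, G.HasNbrIn A u → J.card + 2 - k ≤ (A.filter (G.Adj u)).card := by
    rintro u ⟨a, ha, hua⟩
    have := hfree.card_lt_card_filter_add A hAind ha hua
    omega
  have htwo : ∀ u, G.HasNbrIn A u → ∀ a, ∃ b ∈ A, b ≠ a ∧ G.Adj u b := by
    intro u hu a
    have := hm u hu
    obtain ⟨b, hb, hba⟩ := Finset.exists_mem_ne (s := A.filter (G.Adj u)) (by omega) a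
    exact ⟨b, (Finset.mem_filter.1 hb).1, hba, (Finset.mem_filter.1 hb).2⟩
  have hoffZ : ∀ y, (∀ i, c i ≠ y) → ¬ G.HasNbrIn A y := fun y hy =>
    h.not_hasNbrIn_of_off hx hA htwo hoff hy
  set Z := Finset.univ.filter fun v => ¬ G.HasNbrIn A v with hZ
  set R := Finset.univ.filter fun v => G.HasNbrIn A v with hR
  have hmemZ : ∀ v, v ∈ Z ↔ ¬ G.HasNbrIn A v := fun v => by simp [hZ]
  have hAZ : A ⊆ Z := fun a ha => (hmemZ a).2 fun hn => h.notMem_of_hasNbrIn hx hA hn ha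
  have hxZ : x ∈ Z := hAZ hA.self_mem
  have hZcard : J.card + 1 ≤ Z.card := hAcard ▸ Finset.card_le_card hAZ
  -- Neither end of an edge in `Z` has a neighbour in `A`, and $|A|=d+1\ge k$.
  have hZind : ∀ a b, a ∈ Z → b ∈ Z → ¬ G.Adj a b := by
    intro a b ha hb hab
    rw [hmemZ] at ha hb
    have hlt := hfree.card_lt hab A hAind
      (fun y hy => ⟨fun he => hb ⟨a, he ▸ hy, hab.symm⟩, fun hay => ha ⟨y, hy, hay⟩⟩)
      (fun y hy => ⟨fun he => ha ⟨b, he ▸ hy, hab⟩, fun hby => hb ⟨y, hy, hby⟩⟩)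
    omega
  -- Toughness for the cut `R`: each vertex of the independent set `Z` is a part of its own.
  have hZR : 7 * k * Z.card ≤ 10 * R.card + 6 * Z.card := by
    have hnR : ∀ v, v ∉ R → v ∈ Z := by
      intro v hv
      rw [hmemZ]
      simpa [hR] using hv
    have key := htough.mul_card_le ht (ι := Z) (by rw [Fintype.card_coe]; omega) R
      (fun v => if hv : v ∈ Z then ⟨v, hv⟩ else ⟨x, hxZ⟩)
      (fun a b ha hb hab => absurd hab (hZind a b (hnR a ha) (hnR b hb)))
      (fun v => ⟨v, by simpa [hR] using (hmemZ v).1 v.2, by simp⟩)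
    rw [Fintype.card_coe] at key
    have : 7 * (k : ℝ) * Z.card ≤ 10 * R.card + 6 * Z.card := by linarith
    exact_mod_cast this
  have hRC : ∀ v ∈ R, v ∉ Z ∧ ∃ i, c i = v := by
    intro v hv
    have hv := (Finset.mem_filter.1 hv).2
    refine ⟨fun hvZ => (hmemZ v).1 hvZ hv, ?_⟩
    by_contra! hn
    exact hoffZ v hn hv
  have hI : ((Finset.range N).filter fun i => c i ∈ Z).card + 1 ≤ Z.card := by
    set I := (Finset.range N).filter fun i => c i ∈ Z
    rw [← Finset.card_image_of_injOn (s := I)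
      ((h.injOn_range_add 0).mono (Finset.filter_subset _ _))]
    have hxI : x ∉ I.image fun i => c (i + 0) := by
      intro hmem
      obtain ⟨i, -, hi⟩ := Finset.mem_image.1 hmem
      exact hx _ hi
    rw [← Finset.card_insert_of_notMem hxI]
    refine Finset.card_le_card (Finset.insert_subset hxZ fun v hv => ?_)
    obtain ⟨i, hi, rfl⟩ := Finset.mem_image.1 hv
    exact (Finset.mem_filter.1 hi).2
  have hrun : ∀ r, (∀ j, ¬ ∀ e ≤ r, G.HasNbrIn A (c (j + e))) →
      R.card ≤ r * ((Finset.range N).filter fun i => c i ∈ Z).card := by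
    intro r hr
    refine h.card_le_mul_card hRC fun j => ?_
    have := hr j
    push Not at this
    obtain ⟨e, he, hn⟩ := this
    exact ⟨e, he, (hmemZ _).2 hn⟩
  -- A run of four needs $3d\le4k-7$, which is impossible as $5d\ge7k-6$.
  have hR3 := hrun 3 fun j hj => by
    have := h.four_mul_le_card hx hA htwo hm (hj 0 (by omega)) (hj 1 (by omega))
      (hj 2 (by omega)) (hj 3 (by omega))
    omega
  -- A run of three needs $2d\le3k-5$, hence $k\ge13$; the bound $|R|\le3(|Z|-1)$ already excludes
  -- such $k$.
  have hk13 : k < 13 := by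
    by_contra! hge
    have := Nat.mul_le_mul_right Z.card (show 91 ≤ 7 * k by omega)
    omega
  have hR2 := hrun 2 fun j hj => by
    have := h.three_mul_le_card hx hA htwo hm (hj 0 (by omega)) (hj 1 (by omega))
      (hj 2 (by omega))
    omega
  -- For $k\ge4$ toughness gives $|R|\ge\frac{11}{5}|Z|$, against $|R|\le2(|Z|-1)$.
  obtain rfl : k = 3 := by
    by_contra hne
    have := Nat.mul_le_mul_right Z.card (show 28 ≤ 7 * k by omega)
    omega
  -- For $k=3$ a run of two needs $2(d-1)\le d+1$, so $d\le3$; without such runs $|R|<|Z|$.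
  have hJ3 : J.card = 3 := by
    by_contra hne
    have hR1 := hrun 1 fun j hj => by
      have := h.two_mul_le_card hx hA htwo hm (hj 0 (by omega)) (hj 1 (by omega))
      omega
    omega
  have hZR' : 3 * Z.card ≤ 2 * R.card := by omega
  refine h.false_of_card_eq_four hx hA (by omega) htwo hoffZ
    (fun u hu => by have := hm u hu; omega) hJ3 ?_ ?_ ?_
  · simpa only [hmemZ] using hI
  · convert hZR'
  · convert htough using 1
    norm_num

end IsLongestCycle

end SimpleGraph

theorem corollary1p8 {V : Type*} [Fintype V] [DecidableEq V] (G : SimpleGraph V)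
    (hV : 3 ≤ Fintype.card V) (k : ℕ) (hk : 3 ≤ k)
    (htough : G.IsTough ((7 * (k : ℝ) - 6) / 10))
    (hfree : G.IsInducedFree (SimpleGraph.edgeUnionIsolated k)) :
    G.IsHamiltonian ∨ Nonempty (G ≃g SimpleGraph.petersenGraph) := by
  refine .inl ?_
  have hk' : (3 : ℝ) ≤ k := by exact_mod_cast hk
  -- In an edgeless graph the empty cut violates toughness, as $(7k-6)/10>0$.
  obtain ⟨u, v, huv⟩ : ∃ u v, G.Adj u v := by
    by_contra! hno
    have := htough.mul_card_le (by linarith) (show 2 ≤ Fintype.card V by omega) ∅ id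
      (fun a b _ _ hab => absurd hab (hno a b)) (fun a => ⟨a, by simp, rfl⟩)
    have hV' : (3 : ℝ) ≤ Fintype.card V := by exact_mod_cast hV
    rw [Finset.card_empty, Nat.cast_zero] at this
    have : 0 < (7 * (k : ℝ) - 6) / 10 * Fintype.card V :=
      mul_pos (by linarith) (by linarith)
    linarith
  obtain ⟨c, N, h⟩ := SimpleGraph.exists_isLongestCycle huv
  have hN := h.two_le
  have hp := h.hasPathOn_arc (i := 0) (j := N - 1) (by omega) (by omega)
  have huniv : (Finset.Icc 0 (N - 1)).image c = Finset.univ := by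
    refine Finset.eq_univ_of_forall fun x => ?_
    obtain ⟨i, rfl⟩ := h.exists_apply_eq hk htough hfree x
    obtain ⟨l, hl, hli⟩ := h.exists_lt i
    exact Finset.mem_image.2 ⟨l, Finset.mem_Icc.2 (by omega), hli⟩
  rw [huniv] at hp
  refine SimpleGraph.isHamiltonian_of_hasPathOn_univ hV hp ?_
  have := h.adj (N - 1)
  rwa [Nat.sub_add_cancel (by omega), ← Nat.zero_add N, h.periodic, Nat.zero_add] at this
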